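/- **Theorem 4.1** (radio number of level-wise regular tree $\Box\, K_n$). All graphs are finite. A radio labelling of a connected graph $G$ is a map $f:V(G)\to\{0,1,2,\dots\}$ with $|f(u)-f(v)|\ge \operatorname{diam}(G)+1-d(u,v)$ for all distinct vertices $u,v$; its span is $\max_{u,v}|f(u)-f(v)|$, and $\operatorname{rn}(G)$ is the minimum span of a radio labelling of $G$. A tree $T$ is a level-wise regular tree $T^z=T^z_{d_0,\dots,d_{h-1}}$ if its center (the set of vertices of minimum eccentricity) has exactly $z\in\{1,2\}$ vertices, $h$ is the largest distance of a vertex from the center, and for $0\le i\le h-1$ every vertex at distance $i$ from the center has degree $d_i$. Let $h\ge 1$, let $d_0,\dots,d_{h-1}\ge 3$ and $n\ge 3$ be integers, and let $T^z=T^z_{d_0,\dots,d_{h-1}}$. Then $$\operatorname{rn}(T^1\,\Box\,K_n)=\Bigl[\sum_{i=1}^{h-1}(2h-2i-1)\prod_{j=1}^{i}(d_j-1)+2h-1\Bigr]n\,d_0+(2h+1)(n-1),$$ $$\operatorname{rn}(T^2\,\Box\,K_n)=\Bigl[\sum_{i=0}^{h-1}(2h-2i-1)\prod_{j=0}^{i}(d_j-1)+2h+1\Bigr]2n-2h-1.$$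 Moreover, in both cases $T=T^z$ satisfies $$\operatorname{rn}(T\,\Box\,K_n)=(mn-1)\bigl(\operatorname{diam}(T)+\varepsilon(T)\bigr)-2n\,L(T),$$ where $m=|V(T)|$; $W(T)$ is the set of weight centers of $T$, i.e. the vertices $v$ minimizing $\sum_{u\in V(T)}d(u,v)$; $L(T)=\sum_{u\in V(T)}\min_{x\in W(T)}d(u,x)$; and $\varepsilon(T)=1$ if $|W(T)|=1$, $\varepsilon(T)=0$ if $|W(T)|=2$. -/

import Mathlib

open SimpleGraph

noncomputable section

/-- `f : V → ℕ` is a radio labelling of `G` if `|f u - f v| ≥ diam G + 1 - d(u, v)` for all pairs of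
distinct vertices. The inequality is between integers. -/
def IsRadioLabelling {V : Type*} (G : SimpleGraph V) (f : V → ℕ) : Prop :=
  ∀ u v : V, u ≠ v → (G.diam : ℤ) + 1 - (G.dist u v : ℤ) ≤ |(f u : ℤ) - (f v : ℤ)|

/-- The span `max {|f u - f v| : u, v ∈ V}` of a labelling of a finite vertex set. -/
def labellingSpan {V : Type*} [Fintype V] (f : V → ℕ) : ℕ :=
  Finset.univ.sup fun p : V × V => ((f p.1 : ℤ) - (f p.2 : ℤ)).natAbs

/-- The radio number: the minimum span of a radio labelling of a finite graph. -/
def radioNumber {V : Type*} [Fintype V] (G : SimpleGraph V) : ℕ :=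
  sInf {k : ℕ | ∃ f : V → ℕ, IsRadioLabelling G f ∧ labellingSpan f = k}

/-- The level of `v` relative to a (nonempty) set `R` of roots: `min {d(v, x) : x ∈ R}`. -/
def levelFrom {V : Type*} (G : SimpleGraph V) (R : Set V) (v : V) : ℕ :=
  sInf ((fun x => G.dist v x) '' R)

/-- `T` is a level-wise regular tree `T^z` with degree sequence `(d 0, …, d (h - 1))`: it is a tree
whose center (Mathlib's `SimpleGraph.center`, the vertices of minimum eccentricity) consists of `z`
vertices, `h` is the largest distance of a vertex from the center, and every vertex at distance
`i < h` from the center has degree `d i`. (The values `d i` with `h ≤ i` play no role.) -/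
structure IsLevelwiseRegularTree {V : Type*} (T : SimpleGraph V) (z h : ℕ) (d : ℕ → ℕ) : Prop where
  isTree : T.IsTree
  ncard_center : T.center.ncard = z
  level_le : ∀ v, levelFrom T T.center v ≤ h
  exists_level_eq : ∃ v, levelFrom T T.center v = h
  degree_eq : ∀ v, levelFrom T T.center v < h →
    (T.neighborSet v).ncard = d (levelFrom T T.center v)

/-- The weight `w_T(v) = ∑ u, d(u, v)` of a graph from a vertex. -/
def weightFrom {V : Type*} [Fintype V] (T : SimpleGraph V) (v : V) : ℕ :=
  ∑ u, T.dist u v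

/-- The set `W(T)` of weight centers: the vertices that minimize `weightFrom T`. -/
def weightCenters {V : Type*} [Fintype V] (T : SimpleGraph V) : Set V :=
  {v | ∀ u, weightFrom T v ≤ weightFrom T u}

/-- The total level `L(T)`: the sum of the distances of the vertices to the set of weight
centers. -/
def totalLevel {V : Type*} [Fintype V] (T : SimpleGraph V) : ℕ :=
  ∑ u, levelFrom T (weightCenters T) u

open Classical in
/-- `ε(T)`, equal to `1` if there is exactly one weight center and to `0` otherwise (a tree has one or
two weight centers). -/
def weightEpsilon {V : Type*} [Fintype V] (T : SimpleGraph V) : ℕ :=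
  if (weightCenters T).ncard = 1 then 1 else 0

/-- The general lower bound `(m n - 1)(diam T + ε(T)) - 2 n L(T)` for the radio number of the
Cartesian product of a tree `T` of order `m` with `K_n`. -/
def radioLowerBound {V : Type*} [Fintype V] (T : SimpleGraph V) (n : ℕ) : ℤ :=
  ((Fintype.card V : ℤ) * n - 1) * ((T.diam : ℤ) + weightEpsilon T) - 2 * n * totalLevel T

end

/-!
The lower bound. Let `L v` be the distance of `v` from the center of `T`. Two vertices of the
product are at distance at most `L u + L v + z`, and the diameter of the product is `2 h + z`, so
the labels of any two vertices differ by at least `1 + (h - L u) + (h - L v)`. Adding these gaps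
along the vertices in increasing order of their labels counts each `h - L v` twice, except at the
two ends of the order (`exists_card_add_sum_le`).

The bound is attained if the vertices can be ordered so that the order starts and ends at roots
and the greedy labels `gapSum`, for which every consecutive gap has exactly that value, form a
radio labelling (`IsLeveled.radioNumber_eq_of_sequence`). To find such an order, the vertices of
each level are numbered so that the number of a child is congruent to the number of its parent
modulo the size of the level of the parent (`IsLeveled`). Two vertices with a common ancestor of
level `c` then have congruent numbers modulo the size of level `c`, which grows at least like `2 ^
c`; this gives lower bounds for distances (`IsLeveled.dist_cases`), and it means that in the list
by levels and numbers such vertices are far apart. Let `p < q` be the positions of two vertices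
with deepest common ancestor of level `c`. The greedy labels satisfy the radio condition as soon
as `q - p`, plus `1` if the `K_n`-coordinates differ, plus `2 (h - L w)` for some `w` in between,
is at least `2 c + 1 + z`; two vertices on opposite sides of a tree with two central vertices only
need different `K_n`-coordinates if they are consecutive. The list, without the root if there is
only one, is run through `n` times. Within a run the divisibility gives the estimate, except for a
few small values of `q - p`, where the `K_n`-coordinates have to differ; in different runs there
is a vertex of level `0` or `1` in between (`IsLeveled.exists_sequence_of_one_root`,
`IsLeveled.exists_sequence_of_two_roots`).

The weight centers are the central vertices: shifting the numbers in each level cyclically moves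
every vertex to another branch (except a single root), and the sum of the distances from `v` to a
vertex and to its shift is smallest when `v` is central (`IsLeveled.mem_weightCenters_iff`). The
closed formulas then follow by counting the vertices of each level.
-/

/-! ### Trees: closer neighbours, the center, and levels -/

/-- In a tree, a vertex has at most one neighbour that is closer to a given vertex `u`. -/
theorem SimpleGraph.IsTree.eq_of_adj_of_dist_eq {V : Type*} {T : SimpleGraph V} (hT : T.IsTree)
    {u x x' y : V} (hx : T.Adj x y) (hx' : T.Adj x' y) (hd : T.dist u y = T.dist u x + 1)
    (hd' : T.dist u y = T.dist u x' + 1) : x = x' := by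
  obtain ⟨p, hp⟩ := hT.connected.exists_walk_length_eq_dist u x
  obtain ⟨p', hp'⟩ := hT.connected.exists_walk_length_eq_dist u x'
  have h1 : (p.concat hx).IsPath :=
    Walk.isPath_of_length_eq_dist _ (by rw [Walk.length_concat, hp, hd])
  have h2 : (p'.concat hx').IsPath :=
    Walk.isPath_of_length_eq_dist _ (by rw [Walk.length_concat, hp', hd'])
  have h3 := (hT.existsUnique_path u y).unique h1 h2
  have h4 := congrArg Walk.penultimate h3
  simpa using h4

theorem SimpleGraph.Connected.exists_adj_dist_add_one {V : Type*} {T : SimpleGraph V}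
    (hT : T.Connected) {u v : V} (h : u ≠ v) : ∃ w, T.Adj w v ∧ T.dist u w + 1 = T.dist u v := by
  obtain ⟨p, hp⟩ := hT.exists_walk_length_eq_dist v u
  cases p with
  | nil => exact absurd rfl h
  | cons hvw q =>
    rename_i w
    refine ⟨w, hvw.symm, ?_⟩
    rw [Walk.length_cons] at hp
    have h1 := dist_le q
    have h2 := hT.dist_triangle (u := v) (v := w) (w := u)
    rw [dist_eq_one_iff_adj.mpr hvw] at h2
    rw [dist_comm (u := u) (v := w), dist_comm (u := u) (v := v)]
    omega

/-- A geodesic of a tree that starts by moving away from `u` keeps moving away from `u`. -/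
theorem SimpleGraph.IsTree.dist_eq_add_of_adj {V : Type*} {T : SimpleGraph V} (hT : T.IsTree)
    {u b : V} (k : ℕ) : ∀ x y : V, T.Adj x y → T.dist u y = T.dist u x + 1 →
      T.dist b x = T.dist b y + 1 → T.dist b y = k → T.dist u b = T.dist u y + T.dist b y := by
  induction k with
  | zero =>
    intro x y _ _ _ h0
    rw [hT.connected.dist_eq_zero_iff] at h0
    subst h0
    simp
  | succ k ih =>
    intro x y hxy h1 h2 h3
    have hne : b ≠ y := by
      rintro rfl
      simp at h3
    obtain ⟨w, hw, hd⟩ := hT.connected.exists_adj_dist_add_one hne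
    have hwx : w ≠ x := by
      rintro rfl
      omega
    have h4 : T.dist u w = T.dist u y + 1 := by
      rcases hT.dist_eq_dist_add_one_of_adj u hw with h | h
      · exact h
      · exact absurd (hT.eq_of_adj_of_dist_eq hw hxy h h1) hwx
    rw [ih y w hw.symm h4 (by omega) (by omega)]
    omega

/-- The center of a finite tree is a clique: an inner vertex of a path between two central
vertices would have smaller eccentricity. -/
theorem SimpleGraph.IsTree.adj_of_mem_center {V : Type*} [Finite V] {T : SimpleGraph V}
    (hT : T.IsTree) {a b : V} (ha : a ∈ T.center) (hb : b ∈ T.center) (hab : a ≠ b) :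
    T.Adj a b := by
  by_contra hadj
  have h2 : 1 < T.dist b a := by
    rw [dist_comm]
    exact hT.connected.one_lt_dist_of_ne_of_not_adj hab hadj
  obtain ⟨m, hma, hm⟩ := hT.connected.exists_adj_dist_add_one hab.symm
  have key : ∀ u, T.dist u m + 1 ≤ T.dist u a ∨ T.dist u m + 1 ≤ T.dist u b := by
    intro u
    rcases hT.dist_eq_dist_add_one_of_adj u hma with h | h
    · right
      rw [hT.dist_eq_add_of_adj _ a m hma.symm h hm.symm rfl]
      omega
    · left
      omega
  have : Nonempty V := ⟨a⟩
  obtain ⟨u, hu⟩ := T.exists_edist_eq_eccent_of_finite m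
  have hco : ∀ x y, T.edist x y = (T.dist x y : ℕ∞) := fun x y =>
    ((hT.connected x y).coe_dist_eq_edist).symm
  have hle : T.radius ≤ T.eccent m := radius_le_eccent
  rw [mem_center_iff] at ha hb
  have h3 : (T.dist u m : ℕ∞) + 1 ≤ T.radius := by
    rcases key u with h | h
    · rw [← ha]
      refine le_trans ?_ (edist_le_eccent (v := u))
      rw [hco, dist_comm (u := a)]
      exact_mod_cast h
    · rw [← hb]
      refine le_trans ?_ (edist_le_eccent (v := u))
      rw [hco, dist_comm (u := b)]
      exact_mod_cast h
  rw [← hu, hco, dist_comm] at hle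
  have h4 := h3.trans hle
  have h5 : T.dist u m + 1 ≤ T.dist u m := by exact_mod_cast h4
  omega

section Level

variable {V : Type*} {T : SimpleGraph V} {R : Set V}

theorem exists_dist_eq_levelFrom (hR : R.Nonempty) (v : V) :
    ∃ x ∈ R, T.dist v x = levelFrom T R v :=
  Nat.sInf_mem (hR.image _)

theorem levelFrom_le {x : V} (hx : x ∈ R) (v : V) : levelFrom T R v ≤ T.dist v x :=
  Nat.sInf_le ⟨x, hx, rfl⟩

theorem levelFrom_eq_zero_iff (hT : T.Connected) (hR : R.Nonempty) {v : V} :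
    levelFrom T R v = 0 ↔ v ∈ R := by
  constructor
  · intro h
    obtain ⟨x, hx, hd⟩ := exists_dist_eq_levelFrom (T := T) hR v
    rw [h, hT.dist_eq_zero_iff] at hd
    exact hd ▸ hx
  · intro h
    have := levelFrom_le (T := T) h v
    simpa using this

theorem levelFrom_le_add_one (hT : T.Connected) (hR : R.Nonempty) {v w : V} (h : T.Adj v w) :
    levelFrom T R v ≤ levelFrom T R w + 1 := by
  obtain ⟨x, hx, hd⟩ := exists_dist_eq_levelFrom (T := T) hR w
  have h1 := levelFrom_le (T := T) hx v
  have h2 := hT.dist_triangle (u := v) (v := w) (w := x)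
  rw [dist_eq_one_iff_adj.mpr h] at h2
  omega

theorem exists_adj_levelFrom_add_one (hT : T.Connected) (hR : R.Nonempty) {v : V}
    (hv : levelFrom T R v ≠ 0) : ∃ w, T.Adj w v ∧ levelFrom T R v = levelFrom T R w + 1 := by
  obtain ⟨x, hx, hd⟩ := exists_dist_eq_levelFrom (T := T) hR v
  have hne : x ≠ v := by
    rintro rfl
    simp at hd
    exact hv hd.symm
  obtain ⟨w, hw, hdw⟩ := hT.exists_adj_dist_add_one hne
  refine ⟨w, hw, ?_⟩
  have h1 := levelFrom_le (T := T) hx w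
  have h2 := levelFrom_le_add_one hT hR hw.symm
  rw [dist_comm (u := x) (v := w), dist_comm (u := x) (v := v)] at hdw
  omega

/-- The parent of a vertex is unique, also when the tree is rooted at a clique. -/
theorem eq_of_adj_of_levelFrom_eq (hT : T.IsTree) (hR : R.Nonempty)
    (hc : ∀ x ∈ R, ∀ y ∈ R, x ≠ y → T.Adj x y) {v w w' : V} (hw : T.Adj w v) (hw' : T.Adj w' v)
    (h : levelFrom T R v = levelFrom T R w + 1) (h' : levelFrom T R v = levelFrom T R w' + 1) :
    w = w' := by
  obtain ⟨x, hx, hd⟩ := exists_dist_eq_levelFrom (T := T) hR w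
  obtain ⟨x', hx', hd'⟩ := exists_dist_eq_levelFrom (T := T) hR w'
  have h1 := levelFrom_le (T := T) hx v
  have h2 := hT.connected.dist_triangle (u := v) (v := w) (w := x)
  rw [dist_eq_one_iff_adj.mpr hw.symm] at h2
  have h1' := levelFrom_le (T := T) hx' v
  have h2' := hT.connected.dist_triangle (u := v) (v := w') (w := x')
  rw [dist_eq_one_iff_adj.mpr hw'.symm] at h2'
  by_cases hxx : x = x'
  · subst hxx
    refine hT.eq_of_adj_of_dist_eq (u := x) hw hw' ?_ ?_
    · rw [dist_comm, dist_comm (v := w)]; omega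
    · rw [dist_comm, dist_comm (v := w')]; omega
  · exact absurd (by omega) (hT.dist_ne_of_adj v (hc x hx x' hx' hxx))

/-- Adjacent vertices of equal level are both roots. -/
theorem levelFrom_eq_zero_of_adj (hT : T.IsTree) (hR : R.Nonempty)
    (hc : ∀ x ∈ R, ∀ y ∈ R, x ≠ y → T.Adj x y) {v w : V} (hvw : T.Adj v w)
    (h : levelFrom T R v = levelFrom T R w) : levelFrom T R v = 0 := by
  by_contra h0
  obtain ⟨x, hx, hd⟩ := exists_dist_eq_levelFrom (T := T) hR v
  obtain ⟨y, hy, hd'⟩ := exists_dist_eq_levelFrom (T := T) hR w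
  have hxy : x ≠ y := by
    rintro rfl
    refine hT.dist_ne_of_adj x hvw ?_
    rw [dist_comm, dist_comm (v := w)]; omega
  have hadj := hc x hx y hy hxy
  have h1 := levelFrom_le (T := T) hx w
  have h2 := levelFrom_le (T := T) hy v
  have h3 := hT.dist_eq_dist_add_one_of_adj v hadj
  have h4 := hT.dist_eq_dist_add_one_of_adj w hadj
  have hyw : y ≠ w := by
    rintro rfl
    simp at hd'
    omega
  obtain ⟨a, ha, hda⟩ := hT.connected.exists_adj_dist_add_one hyw
  have h5 := hT.dist_eq_dist_add_one_of_adj a hadj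
  have h6 := hT.dist_eq_dist_add_one_of_adj x ha
  rw [dist_comm (u := y) (v := a), dist_comm (u := y) (v := w)] at hda
  rw [dist_comm (u := x) (v := a), dist_comm (u := x) (v := w)] at h6
  have h7 : a = v := by
    refine hT.eq_of_adj_of_dist_eq (u := x) ha hvw ?_ ?_
    · rw [dist_comm, dist_comm (v := a)]; omega
    · rw [dist_comm, dist_comm (v := v)]; omega
  subst h7
  omega

end Level

/-! ### Coordinates on a level-wise regular tree -/

/-- The number of vertices of level `l` in a forest with `z` roots in which every vertex of level
`i` has `b i` children. -/
def levelCard (z : ℕ) (b : ℕ → ℕ) (l : ℕ) : ℕ := z * ∏ i ∈ Finset.range l, b i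

theorem levelCard_zero (z : ℕ) (b : ℕ → ℕ) : levelCard z b 0 = z := by simp [levelCard]

theorem levelCard_succ (z : ℕ) (b : ℕ → ℕ) (l : ℕ) :
    levelCard z b (l + 1) = levelCard z b l * b l := by
  simp [levelCard, Finset.prod_range_succ, mul_assoc]

theorem levelCard_dvd (z : ℕ) (b : ℕ → ℕ) {l k : ℕ} (h : l ≤ k) :
    levelCard z b l ∣ levelCard z b k := by
  induction h with
  | refl => exact dvd_rfl
  | step _ ih => exact ih.trans (by rw [levelCard_succ]; exact dvd_mul_right _ _)

/-- Coordinates on a tree `T` rooted at a clique of `z` vertices: `L v` is the level of `v`, and `φ`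
numbers the vertices of level `l` by `0, …, levelCard z b l - 1` in such a way that the number of
a child is congruent to the number of its parent modulo the size of the level of the parent.
Vertices with consecutive numbers are thus in different branches. -/
structure IsLeveled {V : Type*} (T : SimpleGraph V) (z h : ℕ) (b : ℕ → ℕ) (L φ : V → ℕ) :
    Prop where
  conn : T.Connected
  le : ∀ v, L v ≤ h
  lt : ∀ v, φ v < levelCard z b (L v)
  inj : ∀ u v, L u = L v → φ u = φ v → u = v
  surj : ∀ l ≤ h, ∀ a < levelCard z b l, ∃ v, L v = l ∧ φ v = a
  adj : ∀ u v, T.Adj u v →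
    (L v = L u + 1 ∧ φ v ≡ φ u [MOD levelCard z b (L u)]) ∨
    (L u = L v + 1 ∧ φ u ≡ φ v [MOD levelCard z b (L v)]) ∨ (L u = 0 ∧ L v = 0 ∧ u ≠ v)
  exists_parent : ∀ v, L v ≠ 0 → ∃ u, T.Adj u v ∧ L v = L u + 1
  root_adj : ∀ u v, L u = 0 → L v = 0 → u ≠ v → T.Adj u v

theorem Set.Finite.exists_bijOn_Iio_ncard {α : Type*} {s : Set α} (hs : s.Finite) :
    ∃ g : α → ℕ, Set.BijOn g s (Set.Iio s.ncard) := by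
  classical
  have hc : s.encard = (Set.Iio s.ncard : Set ℕ).encard := by
    rw [← hs.cast_ncard_eq, ← (Set.finite_Iio _).cast_ncard_eq]
    congr 1
    rw [← Finset.coe_Iio, Set.ncard_coe_finset, Nat.card_Iio]
  exact hs.exists_bijOn_of_encard_eq hc

/-- Numbering of the vertices, built level by level: `par` is the parent map, `g r` numbers the
roots, and `g' v` is the index of `v` among its siblings. -/
def numberingAux {V : Type*} (P : ℕ → ℕ) (par : V → V) (g g' : V → ℕ) : ℕ → V → ℕ
  | 0, v => g v
  | l + 1, v => numberingAux P par g g' l (par v) + P l * g' v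

theorem exists_isLeveled {V : Type*} [Finite V] {T : SimpleGraph V} {R : Set V} {h : ℕ} {b : ℕ → ℕ}
    (hT : T.IsTree) (hR : R.Nonempty) (hc : ∀ x ∈ R, ∀ y ∈ R, x ≠ y → T.Adj x y)
    (hle : ∀ v, levelFrom T R v ≤ h)
    (hb : ∀ v, levelFrom T R v < h →
      {w | T.Adj v w ∧ levelFrom T R w = levelFrom T R v + 1}.ncard = b (levelFrom T R v)) :
    ∃ φ : V → ℕ, IsLeveled T R.ncard h b (levelFrom T R) φ := by
  classical
  set L := levelFrom T R with hL
  set C : V → Set V := fun v => {w | T.Adj v w ∧ L w = L v + 1} with hC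
  obtain ⟨g, hg⟩ := (Set.toFinite R).exists_bijOn_Iio_ncard
  choose s hs using fun v => (Set.toFinite (C v)).exists_bijOn_Iio_ncard
  have hpar : ∀ v, ∃ u, L v ≠ 0 → T.Adj u v ∧ L v = L u + 1 := by
    intro v
    by_cases hv : L v = 0
    · exact ⟨v, fun h => absurd hv h⟩
    · obtain ⟨u, hu⟩ := exists_adj_levelFrom_add_one hT.connected hR hv
      exact ⟨u, fun _ => hu⟩
  choose par hpar using hpar
  have hparC : ∀ u v, T.Adj u v → L v = L u + 1 → par v = u := fun u v h1 h2 =>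
    have h3 := hpar v (by omega)
    eq_of_adj_of_levelFrom_eq hT hR hc h3.1 h1 h3.2 h2
  set P := levelCard R.ncard b with hP
  set Φ := numberingAux P par g (fun v => s (par v) v) with hΦ
  have hmem : ∀ v, L v ≠ 0 → v ∈ C (par v) := fun v hv => hpar v hv
  have hs_lt : ∀ v, L v ≠ 0 → s (par v) v < b (L (par v)) := by
    intro v hv
    have h1 := (hs (par v)).mapsTo (hmem v hv)
    have h2 := hle v
    have h3 := (hpar v hv).2
    rw [← hb (par v) (by omega)]
    exact h1
  have hlt : ∀ l v, L v = l → Φ l v < P l := by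
    intro l
    induction l with
    | zero =>
      intro v hv
      rw [hP, levelCard_zero]
      exact hg.mapsTo ((levelFrom_eq_zero_iff hT.connected hR).mp hv)
    | succ l ih =>
      intro v hv
      have h1 := hpar v (by omega)
      have h2 := ih (par v) (by omega)
      have h3 := hs_lt v (by omega)
      rw [show L (par v) = l by omega] at h3
      rw [hP, levelCard_succ]
      change Φ l (par v) + P l * s (par v) v < P l * b l
      calc Φ l (par v) + P l * s (par v) v < P l + P l * s (par v) v := by omega
        _ = P l * (s (par v) v + 1) := by ring
        _ ≤ P l * b l := Nat.mul_le_mul_left _ h3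
  have hinj : ∀ l u v, L u = l → L v = l → Φ l u = Φ l v → u = v := by
    intro l
    induction l with
    | zero =>
      intro u v hu hv huv
      exact hg.injOn ((levelFrom_eq_zero_iff hT.connected hR).mp hu)
        ((levelFrom_eq_zero_iff hT.connected hR).mp hv) huv
    | succ l ih =>
      intro u v hu hv huv
      have hu1 := (hpar u (by omega)).2
      have hv1 := (hpar v (by omega)).2
      have hu2 := hlt l (par u) (by omega)
      have hv2 := hlt l (par v) (by omega)
      change Φ l (par u) + P l * s (par u) u = Φ l (par v) + P l * s (par v) v at huv
      have hm := congrArg (· % P l) huv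
      simp only [Nat.add_mul_mod_self_left, Nat.mod_eq_of_lt hu2, Nat.mod_eq_of_lt hv2] at hm
      have hp := ih (par u) (par v) (by omega) (by omega) hm
      rw [hm] at huv
      have hss : s (par u) u = s (par v) v :=
        Nat.eq_of_mul_eq_mul_left (by omega) (Nat.add_left_cancel huv)
      rw [← hp] at hss
      exact (hs (par u)).injOn (hmem u (by omega)) (hp ▸ hmem v (by omega)) hss
  have hsurj : ∀ l, l ≤ h → ∀ a < P l, ∃ v, L v = l ∧ Φ l v = a := by
    intro l
    induction l with
    | zero =>
      intro _ a ha
      rw [hP, levelCard_zero] at ha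
      obtain ⟨v, hv, hva⟩ := hg.surjOn ha
      exact ⟨v, (levelFrom_eq_zero_iff hT.connected hR).mpr hv, hva⟩
    | succ l ih =>
      intro hl a ha
      rw [hP, levelCard_succ] at ha
      have hpos : 0 < P l := Nat.pos_of_ne_zero fun h0 => by
        rw [← hP, h0] at ha; simp at ha
      obtain ⟨p, hp, hpa⟩ := ih (by omega) (a % P l) (Nat.mod_lt _ hpos)
      have h1 : a / P l < (C p).ncard := by
        rw [hC, hb p (by omega), hp]
        exact Nat.div_lt_of_lt_mul ha
      obtain ⟨v, hv, hva⟩ := (hs p).surjOn h1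
      have hpv := hparC p v hv.1 hv.2
      refine ⟨v, by rw [hv.2, hp], ?_⟩
      change Φ l (par v) + P l * s (par v) v = a
      rw [hpv, hpa, hva, Nat.mod_add_div]
  have hchild : ∀ u v, T.Adj u v → L v = L u + 1 → Φ (L v) v ≡ Φ (L u) u [MOD P (L u)] := by
    intro u v h1 h2
    rw [h2]
    change Φ (L u) (par v) + P (L u) * s (par v) v ≡ _ [MOD _]
    rw [hparC u v h1 h2]
    simp [Nat.ModEq]
  refine ⟨fun v => Φ (L v) v, hT.connected, hle, fun v => hlt _ v rfl, ?_, ?_, ?_, ?_, ?_⟩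
  · intro u v h1 h2
    exact hinj (L v) u v h1 rfl (by simpa [h1] using h2)
  · intro l hl a ha
    obtain ⟨v, hv, hva⟩ := hsurj l hl a ha
    exact ⟨v, hv, by simpa [hv] using hva⟩
  · intro u v huv
    have h1 : L u ≤ L v + 1 := levelFrom_le_add_one hT.connected hR huv
    have h2 : L v ≤ L u + 1 := levelFrom_le_add_one hT.connected hR huv.symm
    rcases lt_trichotomy (L u) (L v) with h3 | h3 | h3
    · exact Or.inl ⟨by omega, hchild u v huv (by omega)⟩
    · have h4 : L u = 0 := levelFrom_eq_zero_of_adj hT hR hc huv h3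
      exact Or.inr (Or.inr ⟨h4, by omega, huv.ne⟩)
    · exact Or.inr (Or.inl ⟨by omega, hchild v u huv.symm (by omega)⟩)
  · exact fun v hv => exists_adj_levelFrom_add_one hT.connected hR hv
  · intro u v hu hv huv
    exact hc u ((levelFrom_eq_zero_iff hT.connected hR).mp hu) v
      ((levelFrom_eq_zero_iff hT.connected hR).mp hv) huv

/-- The number of children of a vertex of level `i` in the level-wise regular tree with `z` central
vertices and degrees `d i`: a vertex other than a root has a parent, and a root has `z - 1`
neighbours that are roots. -/
def childCount (z : ℕ) (d : ℕ → ℕ) (i : ℕ) : ℕ := if i = 0 then d 0 + 1 - z else d i - 1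

theorem IsLevelwiseRegularTree.exists_isLeveled {V : Type*} [Finite V] {T : SimpleGraph V}
    {z h : ℕ} {d : ℕ → ℕ} (hT : IsLevelwiseRegularTree T z h d) :
    ∃ φ : V → ℕ, IsLeveled T z h (childCount z d) (levelFrom T T.center) φ := by
  have := hT.isTree.connected.nonempty
  have hR : T.center.Nonempty := center_nonempty
  have hc : ∀ x ∈ T.center, ∀ y ∈ T.center, x ≠ y → T.Adj x y :=
    fun x hx y hy hxy => hT.isTree.adj_of_mem_center hx hy hxy
  have key := _root_.exists_isLeveled (b := childCount z d) hT.isTree hR hc hT.level_le ?_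
  · rwa [hT.ncard_center] at key
  intro v hv
  have hdeg := hT.degree_eq v hv
  set L := levelFrom T T.center with hL
  set C := {w | T.Adj v w ∧ L w = L v + 1}
  by_cases h0 : L v = 0
  · have hvR : v ∈ T.center := (levelFrom_eq_zero_iff hT.isTree.connected hR).mp h0
    have hU : T.neighborSet v = C ∪ (T.center \ {v}) := by
      ext w
      simp only [mem_neighborSet, Set.mem_union, Set.mem_sdiff, Set.mem_singleton_iff, C,
        Set.mem_ofPred_eq]
      constructor
      · intro h1
        have h2 : L w ≤ L v + 1 := levelFrom_le_add_one hT.isTree.connected hR h1.symm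
        by_cases h3 : L w = 0
        · exact Or.inr ⟨(levelFrom_eq_zero_iff hT.isTree.connected hR).mp h3, h1.ne'⟩
        · exact Or.inl ⟨h1, by omega⟩
      · rintro (h1 | h1)
        · exact h1.1
        · exact hc v hvR w h1.1 (Ne.symm h1.2)
    have hdisj : Disjoint C (T.center \ {v}) := by
      rw [Set.disjoint_left]
      rintro w ⟨_, h1⟩ ⟨h2, _⟩
      have : L w = 0 := (levelFrom_eq_zero_iff hT.isTree.connected hR).mpr h2
      omega
    rw [hU, Set.ncard_union_eq hdisj, Set.ncard_sdiff_singleton_of_mem hvR, hT.ncard_center,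
      h0] at hdeg
    have hz : 0 < T.center.ncard := (Set.ncard_pos).mpr hR
    rw [hT.ncard_center] at hz
    simp only [childCount, h0, if_true]
    omega
  · obtain ⟨p, hp, hpl⟩ := exists_adj_levelFrom_add_one hT.isTree.connected hR h0
    change L v = L p + 1 at hpl
    have hU : T.neighborSet v = insert p C := by
      ext w
      simp only [mem_neighborSet, Set.mem_insert_iff, C, Set.mem_ofPred_eq]
      constructor
      · intro h1
        have h2 : L w ≤ L v + 1 := levelFrom_le_add_one hT.isTree.connected hR h1.symm
        have h3 : L v ≤ L w + 1 := levelFrom_le_add_one hT.isTree.connected hR h1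
        rcases lt_trichotomy (L v) (L w) with h4 | h4 | h4
        · exact Or.inr ⟨h1, by omega⟩
        · exact absurd (levelFrom_eq_zero_of_adj hT.isTree hR hc h1 h4) h0
        · exact Or.inl (eq_of_adj_of_levelFrom_eq hT.isTree hR hc h1.symm hp
            (show L v = L w + 1 by omega) hpl)
      · rintro (rfl | h1)
        · exact hp.symm
        · exact h1.1
    have hpC : p ∉ C := by
      rintro ⟨_, h1⟩
      omega
    rw [hU, Set.ncard_insert_of_notMem hpC] at hdeg
    simp only [childCount, h0, if_false]
    omega

/-! ### Distances, diameters and weight centers in coordinates -/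

namespace IsLeveled

variable {V : Type*} {T : SimpleGraph V} {z h : ℕ} {b : ℕ → ℕ} {L φ : V → ℕ}

theorem eq_of_modEq_of_level_eq_zero (H : IsLeveled T z h b L φ) {r s : V} (hr : L r = 0)
    (hs : L s = 0) (hrs : φ r ≡ φ s [MOD z]) : r = s := by
  have h1 := H.lt r
  have h2 := H.lt s
  rw [hr, levelCard_zero] at h1
  rw [hs, levelCard_zero] at h2
  exact H.inj r s (by omega) (Nat.ModEq.eq_of_lt_of_lt hrs h1 h2)

/-- Lower bound on the length of a walk: either its ends have a common ancestor at some level `c`,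
or they lie above different roots. -/
theorem length_cases (H : IsLeveled T z h b L φ) (hz : z = 1 ∨ z = 2) {u v : V}
    (p : T.Walk u v) :
    (∃ c, c ≤ L u ∧ c ≤ L v ∧ φ u ≡ φ v [MOD levelCard z b c] ∧ L u + L v ≤ p.length + 2 * c) ∨
    (¬ φ u ≡ φ v [MOD z] ∧ L u + L v + 1 ≤ p.length) := by
  induction p with
  | nil => exact Or.inl ⟨_, le_rfl, le_rfl, Nat.ModEq.refl _, by simp; omega⟩
  | @cons u w v hadj p ih =>
    rw [Walk.length_cons]
    have hdvd : ∀ l, z ∣ levelCard z b l := fun l => dvd_mul_right _ _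
    rcases H.adj u w hadj with ⟨h1, h2⟩ | ⟨h1, h2⟩ | ⟨h1, h2, h3⟩
    · rcases ih with ⟨c, hc1, hc2, hc3, hc4⟩ | ⟨h4, h5⟩
      · left
        by_cases hc : c ≤ L u
        · exact ⟨c, hc, hc2, ((h2.of_dvd (levelCard_dvd z b hc)).symm).trans hc3, by omega⟩
        · have hcu : L u + 1 = c := by omega
          subst hcu
          exact ⟨L u, le_rfl, by omega,
            h2.symm.trans (hc3.of_dvd (levelCard_dvd z b (Nat.le_succ _))), by omega⟩
      · right
        exact ⟨fun h6 => h4 ((h2.of_dvd (hdvd _)).trans h6), by omega⟩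
    · rcases ih with ⟨c, hc1, hc2, hc3, hc4⟩ | ⟨h4, h5⟩
      · left
        exact ⟨c, by omega, hc2, (h2.of_dvd (levelCard_dvd z b hc1)).trans hc3, by omega⟩
      · right
        exact ⟨fun h6 => h4 ((h2.of_dvd (hdvd _)).symm.trans h6), by omega⟩
    · have hne : ¬ φ u ≡ φ w [MOD z] := fun h4 => h3 (H.eq_of_modEq_of_level_eq_zero h1 h2 h4)
      rcases ih with ⟨c, hc1, hc2, hc3, hc4⟩ | ⟨h4, h5⟩
      · right
        have hc0 : c = 0 := by omega
        rw [hc0, levelCard_zero] at hc3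
        exact ⟨fun h6 => hne (h6.trans hc3.symm), by omega⟩
      · left
        refine ⟨0, by omega, by omega, ?_, by omega⟩
        rw [levelCard_zero]
        unfold Nat.ModEq at *
        rcases hz with rfl | rfl <;> omega

theorem dist_cases (H : IsLeveled T z h b L φ) (hz : z = 1 ∨ z = 2) (u v : V) :
    (∃ c, c ≤ L u ∧ c ≤ L v ∧ φ u ≡ φ v [MOD levelCard z b c] ∧
      L u + L v ≤ T.dist u v + 2 * c) ∨
    (¬ φ u ≡ φ v [MOD z] ∧ L u + L v + 1 ≤ T.dist u v) := by
  obtain ⟨p, hp⟩ := H.conn.exists_walk_length_eq_dist u v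
  rw [← hp]
  exact H.length_cases hz p

theorem exists_root_dist_le (H : IsLeveled T z h b L φ) (u : V) :
    ∃ r, L r = 0 ∧ φ u ≡ φ r [MOD z] ∧ T.dist u r ≤ L u := by
  generalize hl : L u = l
  induction l generalizing u with
  | zero => exact ⟨u, hl, Nat.ModEq.refl _, by simp⟩
  | succ l ih =>
    obtain ⟨p, hp, hpl⟩ := H.exists_parent u (by omega)
    obtain ⟨r, hr, h1, h2⟩ := ih p (by omega)
    refine ⟨r, hr, ?_, ?_⟩
    · refine Nat.ModEq.trans ?_ h1
      rcases H.adj p u hp with ⟨_, h3⟩ | ⟨h3, _⟩ | ⟨_, h3, _⟩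
      · exact h3.of_dvd (dvd_mul_right _ _)
      · omega
      · omega
    · have h3 := H.conn.dist_triangle (u := u) (v := p) (w := r)
      rw [dist_eq_one_iff_adj.mpr hp.symm] at h3
      omega

theorem dist_le_one_of_level_eq_zero (H : IsLeveled T z h b L φ) {r s : V} (hr : L r = 0)
    (hs : L s = 0) : T.dist r s ≤ 1 := by
  by_cases hrs : r = s
  · simp [hrs]
  · exact (dist_eq_one_iff_adj.mpr (H.root_adj r s hr hs hrs)).le

theorem dist_root_of_modEq (H : IsLeveled T z h b L φ) (hz : z = 1 ∨ z = 2) {u r : V}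
    (hr : L r = 0) (hur : φ u ≡ φ r [MOD z]) : T.dist u r = L u := by
  obtain ⟨s, hs, h1, h2⟩ := H.exists_root_dist_le u
  obtain rfl := H.eq_of_modEq_of_level_eq_zero hr hs (hur.symm.trans h1)
  rcases H.dist_cases hz u r with ⟨c, _, h3, _, h4⟩ | ⟨h3, _⟩
  · omega
  · exact absurd hur h3

theorem dist_root_of_not_modEq (H : IsLeveled T z h b L φ) (hz : z = 1 ∨ z = 2) {u r : V}
    (hr : L r = 0) (hur : ¬ φ u ≡ φ r [MOD z]) : T.dist u r = L u + 1 := by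
  obtain ⟨s, hs, h1, h2⟩ := H.exists_root_dist_le u
  have h3 := H.dist_le_one_of_level_eq_zero hs hr
  have h4 := H.conn.dist_triangle (u := u) (v := s) (w := r)
  rcases H.dist_cases hz u r with ⟨c, _, h5, h6, _⟩ | ⟨_, h5⟩
  · have hc0 : c = 0 := by omega
    rw [hc0, levelCard_zero] at h6
    exact absurd h6 hur
  · omega

theorem dist_le (H : IsLeveled T z h b L φ) (hz : z = 1 ∨ z = 2) (u v : V) :
    T.dist u v ≤ L u + L v + (z - 1) := by
  obtain ⟨r, hr, h1, h2⟩ := H.exists_root_dist_le v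
  have h3 := H.conn.dist_triangle (u := u) (v := r) (w := v)
  rw [dist_comm (u := r)] at h3
  by_cases hur : φ u ≡ φ r [MOD z]
  · rw [H.dist_root_of_modEq hz hr hur] at h3
    omega
  · rw [H.dist_root_of_not_modEq hz hr hur] at h3
    rcases hz with rfl | rfl
    · exact absurd (Nat.modEq_one) hur
    · omega

/-- The sizes of the levels are large compared with the corresponding depths. -/
theorem le_levelCard (hb : ∀ i < h, 2 ≤ b i) (hb0 : z = 1 → 3 ≤ b 0) (hz : z = 1 ∨ z = 2) (c : ℕ)
    (hc1 : 1 ≤ c) (hch : c ≤ h) :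
    3 ≤ levelCard z b c ∧ (2 ≤ c → 2 * c + 2 ≤ levelCard z b c) ∧
      (z = 2 → 4 ≤ levelCard z b c ∧ (2 ≤ c → 2 * c + 4 ≤ levelCard z b c)) := by
  have h1 : 3 ≤ levelCard z b 1 ∧ (z = 2 → 4 ≤ levelCard z b 1) := by
    rw [levelCard_succ, levelCard_zero]
    have := hb 0 (by omega)
    rcases hz with rfl | rfl
    · have := hb0 rfl
      omega
    · omega
  induction c, hc1 using Nat.le_induction with
  | base => exact ⟨h1.1, by omega, fun h => ⟨h1.2 h, by omega⟩⟩
  | succ c hc ih =>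
    obtain ⟨h2, h3, h4⟩ := ih (by omega)
    have h5 : 2 * levelCard z b c ≤ levelCard z b (c + 1) := by
      rw [levelCard_succ, mul_comm]
      exact Nat.mul_le_mul_left _ (hb c (by omega))
    rcases Nat.lt_or_ge c 2 with hc2 | hc2
    · refine ⟨by omega, by omega, fun h6 => ?_⟩
      have := h4 h6
      omega
    · have := h3 hc2
      refine ⟨by omega, by omega, fun h6 => ?_⟩
      have := h4 h6
      omega

theorem levelCard_pos (hb : ∀ i < h, 2 ≤ b i) (hb0 : z = 1 → 3 ≤ b 0) (hz : z = 1 ∨ z = 2)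
    {l : ℕ} (hl : l ≤ h) : 0 < levelCard z b l := by
  rcases Nat.eq_zero_or_pos l with rfl | h0
  · rw [levelCard_zero]; omega
  · have := (le_levelCard hb hb0 hz l h0 hl).1
    omega

theorem exists_dist_eq (H : IsLeveled T z h b L φ) (hb : ∀ i < h, 2 ≤ b i)
    (hb0 : z = 1 → 3 ≤ b 0) (hz : z = 1 ∨ z = 2) (hh : 1 ≤ h) :
    ∃ u v, u ≠ v ∧ T.dist u v = 2 * h + (z - 1) := by
  have hP := (le_levelCard hb hb0 hz h hh le_rfl).1
  obtain ⟨u, hu, hu'⟩ := H.surj h le_rfl 0 (by omega)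
  obtain ⟨v, hv, hv'⟩ := H.surj h le_rfl 1 (by omega)
  have h1 := H.dist_le hz u v
  rw [hu, hv] at h1
  refine ⟨u, v, ?_, le_antisymm (by omega) ?_⟩
  · rintro rfl
    omega
  rcases H.dist_cases hz u v with ⟨c, h2, h3, h4, h5⟩ | ⟨h2, h3⟩
  · rw [hu', hv'] at h4
    rcases Nat.eq_zero_or_pos c with rfl | hc
    · rw [levelCard_zero] at h4
      rcases hz with rfl | rfl
      · omega
      · simp [Nat.ModEq] at h4
    · have h6 := (le_levelCard hb hb0 hz c hc (by omega)).1
      have := Nat.ModEq.eq_of_lt_of_lt h4 (by omega) (by omega)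
      omega
  · rcases hz with rfl | rfl <;> omega

end IsLeveled

theorem diam_eq_of_dist {V : Type*} [Finite V] {G : SimpleGraph V} (hG : G.Connected) {D : ℕ}
    (hle : ∀ u v, G.dist u v ≤ D) {u v : V} (huv : G.dist u v = D) : G.diam = D := by
  have := hG.nonempty
  obtain ⟨x, y, hxy⟩ := G.exists_dist_eq_diam
  refine le_antisymm (hxy ▸ hle x y) ?_
  rw [← huv]
  exact dist_le_diam (connected_iff_ediam_ne_top.mp hG)

theorem dist_boxProd_completeGraph {V : Type*} {T : SimpleGraph V} (hT : T.Connected) {n : ℕ}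
    (x y : V × Fin n) : (T □ completeGraph (Fin n)).dist x y =
      T.dist x.1 y.1 + if x.2 = y.2 then 0 else 1 := by
  classical
  unfold SimpleGraph.dist
  rw [edist_boxProd, ← (hT x.1 y.1).coe_dist_eq_edist, completeGraph_eq_top, edist_top]
  split_ifs <;> simp

namespace IsLeveled

variable {V : Type*} {T : SimpleGraph V} {z h : ℕ} {b : ℕ → ℕ} {L φ : V → ℕ}

theorem diam_eq [Finite V] (H : IsLeveled T z h b L φ) (hb : ∀ i < h, 2 ≤ b i)
    (hb0 : z = 1 → 3 ≤ b 0) (hz : z = 1 ∨ z = 2) (hh : 1 ≤ h) : T.diam = 2 * h + (z - 1) := by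
  obtain ⟨u, v, _, huv⟩ := H.exists_dist_eq hb hb0 hz hh
  refine diam_eq_of_dist H.conn (fun x y => ?_) huv
  have h1 := H.dist_le hz x y
  have h2 := H.le x
  have h3 := H.le y
  omega

theorem diam_boxProd_eq [Finite V] (H : IsLeveled T z h b L φ) (hb : ∀ i < h, 2 ≤ b i)
    (hb0 : z = 1 → 3 ≤ b 0) (hz : z = 1 ∨ z = 2) (hh : 1 ≤ h) {n : ℕ} (hn : 2 ≤ n) :
    (T □ completeGraph (Fin n)).diam = 2 * h + z := by
  obtain ⟨u, v, _, huv⟩ := H.exists_dist_eq hb hb0 hz hh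
  have : Nonempty (Fin n) := ⟨⟨0, by omega⟩⟩
  have hc : (completeGraph (Fin n)).Connected := by
    rw [completeGraph_eq_top]; exact connected_top
  refine diam_eq_of_dist (H.conn.boxProd hc) (fun x y => ?_)
    (u := (u, ⟨0, by omega⟩)) (v := (v, ⟨1, by omega⟩)) ?_
  · rw [dist_boxProd_completeGraph H.conn]
    have h1 := H.dist_le hz x.1 y.1
    have h2 := H.le x.1
    have h3 := H.le y.1
    split_ifs <;> omega
  · rw [dist_boxProd_completeGraph H.conn, huv]
    simp
    omega

/-- The cyclic shift of the numbers within each level. It moves every vertex, except a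
single root, to another branch, so
the average of its distances before and after the shift to a vertex `v` is smallest when `v` is
a root. -/
theorem exists_shift (H : IsLeveled T z h b L φ) [Finite V] :
    ∃ τ : V → V, Function.Bijective τ ∧ (∀ u, L (τ u) = L u) ∧
      ∀ u, ∀ c ≤ L u, φ (τ u) ≡ φ u + 1 [MOD levelCard z b c] := by
  have key : ∀ u, ∃ v, L v = L u ∧ φ v = (φ u + 1) % levelCard z b (L u) := fun u =>
    H.surj (L u) (H.le u) _ (Nat.mod_lt _ ((Nat.zero_le _).trans_lt (H.lt u)))
  choose τ hτ hτ' using key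
  refine ⟨τ, ?_, hτ, ?_⟩
  · rw [← Finite.injective_iff_bijective]
    intro u v huv
    have h1 : L u = L v := by rw [← hτ u, huv, hτ v]
    have h2 : φ u + 1 ≡ φ v + 1 [MOD levelCard z b (L u)] := by
      have h3 := hτ' u
      rw [huv, hτ' v, ← h1] at h3
      exact h3.symm
    have h3 := H.lt v
    rw [← h1] at h3
    exact H.inj u v h1 (Nat.ModEq.eq_of_lt_of_lt (Nat.ModEq.add_right_cancel' 1 h2) (H.lt u) h3)
  · intro u c hc
    rw [hτ' u]
    exact (Nat.mod_modEq _ _).of_dvd (levelCard_dvd z b hc)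

theorem not_modEq_add_one {k a : ℕ} (hk : 2 ≤ k) : ¬ a + 1 ≡ a [MOD k] := by
  intro h
  have h1 : a + 1 ≡ a + 0 [MOD k] := h
  have h2 := Nat.ModEq.add_left_cancel' a h1
  have := Nat.ModEq.eq_of_lt_of_lt h2 (by omega) (by omega)
  omega

theorem le_dist_add_dist_shift (H : IsLeveled T z h b L φ) (hb : ∀ i < h, 2 ≤ b i)
    (hb0 : z = 1 → 3 ≤ b 0) (hz : z = 1 ∨ z = 2) {τ : V → V} (hτ : ∀ u, L (τ u) = L u)
    (hτ' : ∀ u, ∀ c ≤ L u, φ (τ u) ≡ φ u + 1 [MOD levelCard z b c]) (u v : V) :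
    ∃ c, c ≤ L u ∧ c ≤ L v ∧
      2 * L u + 2 * L v + (z - 1) ≤ T.dist u v + T.dist (τ u) v + 2 * c := by
  have hno : ∀ c, 2 ≤ levelCard z b c → c ≤ L u → φ u ≡ φ v [MOD levelCard z b c] →
      ¬ φ (τ u) ≡ φ v [MOD levelCard z b c] := fun c hc hcu h1 h2 =>
    not_modEq_add_one hc ((hτ' u c hcu).symm.trans (h2.trans h1.symm))
  have hlu := H.le u
  have h1 := H.dist_cases hz u v
  have h2 := H.dist_cases hz (τ u) v
  rw [hτ u] at h2
  rcases h1 with ⟨c, hc1, hc2, hc3, hc4⟩ | ⟨h3, h4⟩ <;>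
    rcases h2 with ⟨e, he1, he2, he3, he4⟩ | ⟨h5, h6⟩
  · rcases hz with rfl | rfl
    · rcases Nat.eq_zero_or_pos c with rfl | hc
      · exact ⟨e, he1, he2, by omega⟩
      rcases Nat.eq_zero_or_pos e with rfl | he
      · exact ⟨c, hc1, hc2, by omega⟩
      have h1c := (le_levelCard hb hb0 (Or.inl rfl) 1 le_rfl (by omega)).1
      exact absurd (he3.of_dvd (levelCard_dvd 1 b he))
        (hno 1 (by omega) (by omega) (hc3.of_dvd (levelCard_dvd 1 b hc)))
    · exact absurd (he3.of_dvd (levelCard_dvd 2 b (Nat.zero_le _)))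
        (hno 0 (by rw [levelCard_zero]) (by omega)
          (hc3.of_dvd (levelCard_dvd 2 b (Nat.zero_le _))))
  · exact ⟨c, hc1, hc2, by omega⟩
  · exact ⟨e, he1, he2, by omega⟩
  · exact ⟨0, by omega, by omega, by omega⟩

theorem dist_add_dist_shift_root (H : IsLeveled T z h b L φ) (hz : z = 1 ∨ z = 2) {τ : V → V}
    (hτ : ∀ u, L (τ u) = L u)
    (hτ' : ∀ u, ∀ c ≤ L u, φ (τ u) ≡ φ u + 1 [MOD levelCard z b c]) (u : V) {r : V}
    (hr : L r = 0) : T.dist u r + T.dist (τ u) r = 2 * L u + (z - 1) := by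
  have h1 := hτ' u 0 (Nat.zero_le _)
  rw [levelCard_zero] at h1
  by_cases h2 : φ u ≡ φ r [MOD z]
  · rw [H.dist_root_of_modEq hz hr h2]
    by_cases h3 : φ (τ u) ≡ φ r [MOD z]
    · rw [H.dist_root_of_modEq hz hr h3, hτ]
      rcases hz with rfl | rfl
      · omega
      · exact absurd (h1.symm.trans (h3.trans h2.symm)) (not_modEq_add_one le_rfl)
    · rw [H.dist_root_of_not_modEq hz hr h3, hτ]
      rcases hz with rfl | rfl
      · exact absurd Nat.modEq_one h3
      · omega
  · rw [H.dist_root_of_not_modEq hz hr h2]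
    rcases hz with rfl | rfl
    · exact absurd Nat.modEq_one h2
    · rw [H.dist_root_of_modEq (Or.inr rfl) hr, hτ]
      · omega
      · unfold Nat.ModEq at *
        omega

theorem two_mul_weightFrom [Fintype V] {τ : V → V} (hτ : Function.Bijective τ) (v : V) :
    2 * weightFrom T v = ∑ u, (T.dist u v + T.dist (τ u) v) := by
  rw [Finset.sum_add_distrib, hτ.sum_comp (fun u => T.dist u v), weightFrom, two_mul]

theorem mem_weightCenters_iff [Fintype V] (H : IsLeveled T z h b L φ) (hb : ∀ i < h, 2 ≤ b i)
    (hb0 : z = 1 → 3 ≤ b 0) (hz : z = 1 ∨ z = 2) (v : V) : v ∈ weightCenters T ↔ L v = 0 := by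
  obtain ⟨τ, hτb, hτ, hτ'⟩ := H.exists_shift
  have hroot : ∀ r, L r = 0 → 2 * weightFrom T r = ∑ u, (2 * L u + (z - 1)) := by
    intro r hr
    rw [two_mul_weightFrom hτb]
    exact Finset.sum_congr rfl fun u _ => H.dist_add_dist_shift_root hz hτ hτ' u hr
  have hle : ∀ v u, 2 * L u + (z - 1) ≤ T.dist u v + T.dist (τ u) v := by
    intro v u
    obtain ⟨c, h1, h2, h3⟩ := H.le_dist_add_dist_shift hb hb0 hz hτ hτ' u v
    omega
  constructor
  · intro hv
    by_contra h0
    obtain ⟨r, hr, _⟩ := H.surj 0 (Nat.zero_le _) 0 (by rw [levelCard_zero]; omega)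
    have h1 : 2 * weightFrom T r < 2 * weightFrom T v := by
      rw [hroot r hr, two_mul_weightFrom hτb]
      refine Finset.sum_lt_sum (fun u _ => hle v u) ⟨r, Finset.mem_univ _, ?_⟩
      obtain ⟨c, h1, h2, h3⟩ := H.le_dist_add_dist_shift hb hb0 hz hτ hτ' r v
      omega
    have h2 := hv r
    omega
  · intro hv u
    have h1 : 2 * weightFrom T v ≤ 2 * weightFrom T u := by
      rw [hroot v hv, two_mul_weightFrom hτb]
      exact Finset.sum_le_sum fun x _ => hle u x
    omega

end IsLeveled

/-! ### Spans of labellings and greedy labels -/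

/-- A labelling whose gaps are at least `1 + e u + e v` has a large span: summing the gaps in
increasing order of the labels counts `e` twice, except at the two ends. -/
theorem exists_card_add_sum_le {α : Type*} [DecidableEq α] {f e : α → ℕ}
    (hf : Function.Injective f) (hgap : ∀ u v, f u < f v → f u + 1 + e u + e v ≤ f v)
    (s : Finset α) : s.Nonempty →
      ∃ x ∈ s, ∃ y ∈ s, (∀ w ∈ s, f w ≤ f y) ∧
        f x + s.card + 2 * ∑ w ∈ s, e w ≤ f y + e x + e y + 1 := by
  induction s using Finset.induction_on_max_value f with
  | empty => intro h; exact absurd h Finset.not_nonempty_empty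
  | insert a s ha hmax ih =>
    intro _
    rcases s.eq_empty_or_nonempty with rfl | hs
    · exact ⟨a, by simp, a, by simp, by simp, by simp; omega⟩
    · obtain ⟨x, hx, y, hy, hmy, hle⟩ := ih hs
      have hya : f y < f a :=
        lt_of_le_of_ne (hmax y hy) fun h => ha (hf h ▸ hy)
      have hg := hgap y a hya
      refine ⟨x, by simp [hx], a, by simp, ?_, ?_⟩
      · intro w hw
        rcases Finset.mem_insert.mp hw with rfl | hw
        · exact le_rfl
        · exact hmax w hw
      · rw [Finset.card_insert_of_notMem ha, Finset.sum_insert ha]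
        omega

theorem natAbs_sub_le_labellingSpan {α : Type*} [Fintype α] (f : α → ℕ) (x y : α) :
    ((f x : ℤ) - (f y : ℤ)).natAbs ≤ labellingSpan f :=
  Finset.le_sup (f := fun p : α × α => ((f p.1 : ℤ) - (f p.2 : ℤ)).natAbs)
    (Finset.mem_univ (x, y))

theorem card_add_sum_le_labellingSpan {α : Type*} [Fintype α] [Nonempty α] {f e : α → ℕ} {h : ℕ}
    (hf : Function.Injective f) (hgap : ∀ u v, f u < f v → f u + 1 + e u + e v ≤ f v)
    (he : ∀ u, e u ≤ h) :
    Fintype.card α + 2 * ∑ w, e w ≤ labellingSpan f + 2 * h + 1 := by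
  classical
  obtain ⟨x, _, y, _, _, hle⟩ := exists_card_add_sum_le hf hgap Finset.univ Finset.univ_nonempty
  have h1 := natAbs_sub_le_labellingSpan f y x
  have h2 := he x
  have h3 := he y
  rw [Finset.card_univ] at hle
  omega

/-- The greedy labels along a sequence of vertices whose consecutive gaps are
`1 + e t + e (t + 1)`. -/
def gapSum (e : ℕ → ℕ) (p : ℕ) : ℕ := ∑ t ∈ Finset.range p, (1 + e t + e (t + 1))

theorem gapSum_add_eq (e : ℕ → ℕ) (p : ℕ) :
    gapSum e p + e 0 + e p + 1 = p + 1 + 2 * ∑ t ∈ Finset.range (p + 1), e t := by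
  induction p with
  | zero => simp [gapSum]; omega
  | succ p ih =>
    rw [gapSum, Finset.sum_range_succ, ← gapSum, Finset.sum_range_succ _ (p + 1)]
    omega

theorem gapSum_add_le (e : ℕ → ℕ) {p q : ℕ} (hpq : p < q) :
    gapSum e p + (q - p) + e p + e q ≤ gapSum e q := by
  have h1 := gapSum_add_eq e p
  have h2 := gapSum_add_eq e q
  have h3 : ∑ t ∈ Finset.range (p + 1), e t + e q ≤ ∑ t ∈ Finset.range (q + 1), e t := by
    rw [Finset.sum_range_succ _ q]
    exact Nat.add_le_add_right
      (Finset.sum_le_sum_of_subset (Finset.range_mono (by omega))) _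
  omega

/-- A term strictly between `p` and `q` contributes twice to the gap between `p` and `q`. -/
theorem gapSum_add_le_of_lt_of_lt (e : ℕ → ℕ) {p t q : ℕ} (hpt : p < t) (htq : t < q) :
    gapSum e p + (q - p) + e p + e q + 2 * e t ≤ gapSum e q := by
  have h1 := gapSum_add_le e hpt
  have h2 := gapSum_add_le e htq
  omega

theorem radioNumber_le_of_sequence {α : Type*} [Fintype α] {G : SimpleGraph α} {s : ℕ → α}
    {e : ℕ → ℕ} (hs : Set.InjOn s (Set.Iio (Fintype.card α)))
    (hgap : ∀ p q, p < q → q < Fintype.card α →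
      G.diam + 1 + gapSum e p ≤ G.dist (s p) (s q) + gapSum e q) :
    ∃ f : α → ℕ, IsRadioLabelling G f ∧ labellingSpan f ≤ gapSum e (Fintype.card α - 1) := by
  have hbij : Function.Bijective (fun i : Fin (Fintype.card α) => s i) := by
    rw [Fintype.bijective_iff_injective_and_card]
    refine ⟨fun i j hij => Fin.ext (hs i.2 j.2 hij), by simp⟩
  set E := Equiv.ofBijective _ hbij with hE
  have hsE : ∀ u, s (E.symm u) = u := fun u => E.apply_symm_apply u
  have hmono : ∀ p q, p ≤ q → gapSum e p ≤ gapSum e q := by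
    intro p q hpq
    rcases hpq.eq_or_lt with rfl | h
    · exact le_rfl
    · have := gapSum_add_le e h
      omega
  refine ⟨fun u => gapSum e (E.symm u), ?_, ?_⟩
  · have key : ∀ u v, (E.symm u : ℕ) < E.symm v →
        (G.diam : ℤ) + 1 - G.dist u v ≤ (gapSum e (E.symm v) : ℤ) - gapSum e (E.symm u) := by
      intro u v huv
      have h1 := hgap _ _ huv (E.symm v).2
      rw [hsE, hsE] at h1
      omega
    intro u v huv
    rcases lt_trichotomy (E.symm u : ℕ) (E.symm v) with h | h | h
    · rw [abs_sub_comm]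
      exact (key u v h).trans (le_abs_self _)
    · exact absurd (E.symm.injective (Fin.ext h)) huv
    · rw [SimpleGraph.dist_comm]
      exact (key v u h).trans (le_abs_self _)
  · refine Finset.sup_le fun p _ => ?_
    have h1 := hmono (E.symm p.1) (Fintype.card α - 1) (by have := (E.symm p.1).2; omega)
    have h2 := hmono (E.symm p.2) (Fintype.card α - 1) (by have := (E.symm p.2).2; omega)
    change ((gapSum e (E.symm p.1) : ℤ) - (gapSum e (E.symm p.2) : ℤ)).natAbs ≤ _
    omega

theorem sum_range_card_eq_sum {α : Type*} [Fintype α] {s : ℕ → α} (e : α → ℕ)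
    (hs : Set.InjOn s (Set.Iio (Fintype.card α))) :
    ∑ t ∈ Finset.range (Fintype.card α), e (s t) = ∑ u, e u := by
  have hbij : Function.Bijective (fun i : Fin (Fintype.card α) => s i) := by
    rw [Fintype.bijective_iff_injective_and_card]
    refine ⟨fun i j hij => Fin.ext (hs i.2 j.2 hij), by simp⟩
  rw [Finset.sum_range, ← hbij.sum_comp]

namespace IsLeveled

variable {V : Type*} {T : SimpleGraph V} {z h : ℕ} {b : ℕ → ℕ} {L φ : V → ℕ}

theorem le_labellingSpan [Fintype V] (H : IsLeveled T z h b L φ) (hb : ∀ i < h, 2 ≤ b i)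
    (hb0 : z = 1 → 3 ≤ b 0) (hz : z = 1 ∨ z = 2) (hh : 1 ≤ h) {n : ℕ} (hn : 2 ≤ n)
    {f : V × Fin n → ℕ} (hf : IsRadioLabelling (T □ completeGraph (Fin n)) f) :
    Fintype.card V * n + 2 * (n * ∑ v, (h - L v)) ≤ labellingSpan f + 2 * h + 1 := by
  have hdiam := H.diam_boxProd_eq hb hb0 hz hh hn
  have hd : ∀ u v : V × Fin n, (T □ completeGraph (Fin n)).dist u v ≤
      L u.1 + L v.1 + z := by
    intro u v
    rw [dist_boxProd_completeGraph H.conn]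
    have := H.dist_le hz u.1 v.1
    split_ifs <;> omega
  have hgap : ∀ u v : V × Fin n, u ≠ v → f u ≤ f v →
      f u + 1 + (h - L u.1) + (h - L v.1) ≤ f v := by
    intro u v huv hle
    have h1 := hf u v huv
    have h2 := hd u v
    have h3 := H.le u.1
    have h4 := H.le v.1
    rw [hdiam, abs_sub_comm, abs_of_nonneg (by omega)] at h1
    omega
  have hinj : Function.Injective f := by
    intro u v huv
    by_contra hne
    have := hgap u v hne huv.le
    omega
  obtain ⟨v0⟩ := H.conn.nonempty
  have : Nonempty (V × Fin n) := ⟨(v0, ⟨0, by omega⟩)⟩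
  have key := card_add_sum_le_labellingSpan (e := fun u : V × Fin n => h - L u.1) (h := h) hinj
    (fun u v huv => hgap u v (fun h0 => by simp [h0] at huv) huv.le) (fun u => Nat.sub_le _ _)
  rw [Fintype.sum_prod_type] at key
  simpa [Finset.mul_sum] using key

/-- The lower bound is attained as soon as some ordering of the vertices starts and ends at roots
and is compatible with the greedy labels. -/
theorem radioNumber_eq_of_sequence [Fintype V] (H : IsLeveled T z h b L φ)
    (hb : ∀ i < h, 2 ≤ b i) (hb0 : z = 1 → 3 ≤ b 0) (hz : z = 1 ∨ z = 2) (hh : 1 ≤ h) {n : ℕ}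
    (hn : 2 ≤ n) {s : ℕ → V × Fin n} (hs : Set.InjOn s (Set.Iio (Fintype.card V * n)))
    (h0 : L (s 0).1 = 0) (h1 : L (s (Fintype.card V * n - 1)).1 = 0)
    (hgap : ∀ p q, p < q → q < Fintype.card V * n →
      2 * h + z + 1 + gapSum (fun t => h - L (s t).1) p ≤
        T.dist (s p).1 (s q).1 + (if (s p).2 = (s q).2 then 0 else 1) +
          gapSum (fun t => h - L (s t).1) q) :
    radioNumber (T □ completeGraph (Fin n)) + 2 * h + 1 =
      Fintype.card V * n + 2 * (n * ∑ v, (h - L v)) := by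
  have hcard : Fintype.card (V × Fin n) = Fintype.card V * n := by simp
  have hdiam := H.diam_boxProd_eq hb hb0 hz hh hn
  rw [← hcard] at hs h1 hgap
  obtain ⟨f, hf, hspan⟩ := radioNumber_le_of_sequence (G := T □ completeGraph (Fin n)) hs
    (e := fun t => h - L (s t).1) (by
      intro p q hpq hq
      rw [dist_boxProd_completeGraph H.conn, hdiam]
      exact hgap p q hpq hq)
  obtain ⟨v0⟩ := H.conn.nonempty
  have hpos : 0 < Fintype.card (V × Fin n) :=
    Fintype.card_pos_iff.mpr ⟨(v0, ⟨0, by omega⟩)⟩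
  have h2 := gapSum_add_eq (fun t => h - L (s t).1) (Fintype.card (V × Fin n) - 1)
  rw [Nat.sub_add_cancel hpos, sum_range_card_eq_sum (fun u : V × Fin n => h - L u.1) hs,
    Fintype.sum_prod_type] at h2
  simp only [h0, h1, Finset.sum_const, Finset.card_univ, Fintype.card_fin, smul_eq_mul,
    ← Finset.mul_sum] at h2
  have h3 : radioNumber (T □ completeGraph (Fin n)) ≤ labellingSpan f :=
    Nat.sInf_le ⟨f, hf, rfl⟩
  obtain ⟨g, hg, hgs⟩ := Nat.sInf_mem (s := {k : ℕ | ∃ f : V × Fin n → ℕ,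
    IsRadioLabelling (T □ completeGraph (Fin n)) f ∧ labellingSpan f = k}) ⟨_, f, hf, rfl⟩
  have h4 := H.le_labellingSpan hb hb0 hz hh hn hg
  rw [hgs] at h4
  change _ ≤ radioNumber (T □ completeGraph (Fin n)) + 2 * h + 1 at h4
  omega

end IsLeveled

/-! ### Listing the vertices level by level -/

namespace IsLeveled

variable {V : Type*} {T : SimpleGraph V} {z h : ℕ} {b : ℕ → ℕ} {L φ : V → ℕ}

theorem sum_levelCard_modEq (z : ℕ) (b : ℕ → ℕ) {c l : ℕ} (hcl : c ≤ l) :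
    ∑ t ∈ Finset.range l, levelCard z b t ≡ ∑ t ∈ Finset.range c, levelCard z b t
      [MOD levelCard z b c] := by
  induction l, hcl using Nat.le_induction with
  | base => exact Nat.ModEq.refl _
  | succ l hl ih =>
    rw [Finset.sum_range_succ]
    exact ih.add (Nat.modEq_zero_iff_dvd.mpr (levelCard_dvd z b hl))

theorem sum_levelCard_le (z : ℕ) (b : ℕ → ℕ) {k l : ℕ} (hkl : k ≤ l) :
    ∑ t ∈ Finset.range k, levelCard z b t ≤ ∑ t ∈ Finset.range l, levelCard z b t :=
  Finset.sum_le_sum_of_subset (Finset.range_mono hkl)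

theorem exists_eq_sum_levelCard_add (z : ℕ) (b : ℕ → ℕ) (k r : ℕ)
    (hr : r < ∑ t ∈ Finset.range k, levelCard z b t) :
    ∃ l < k, ∃ a < levelCard z b l, ∑ t ∈ Finset.range l, levelCard z b t + a = r := by
  induction k with
  | zero => simp at hr
  | succ k ih =>
    by_cases h1 : r < ∑ t ∈ Finset.range k, levelCard z b t
    · obtain ⟨l, hl, ha⟩ := ih h1
      exact ⟨l, by omega, ha⟩
    · rw [Finset.sum_range_succ] at hr
      exact ⟨k, by omega, r - ∑ t ∈ Finset.range k, levelCard z b t, by omega, by omega⟩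

/-- The vertices can be listed level by level, and by number within each level: `vtx r` is the vertex
at position `r`. Sums over the vertices of a function of the level reduce to sums over the levels. -/
theorem exists_enumeration [Fintype V] (H : IsLeveled T z h b L φ) :
    Fintype.card V = ∑ t ∈ Finset.range (h + 1), levelCard z b t ∧
    (∀ f : ℕ → ℕ, ∑ v, f (L v) = ∑ t ∈ Finset.range (h + 1), levelCard z b t * f t) ∧
    ∃ vtx : ℕ → V, ∀ r < Fintype.card V,
      ∑ t ∈ Finset.range (L (vtx r)), levelCard z b t + φ (vtx r) = r := by
  set M := ∑ t ∈ Finset.range (h + 1), levelCard z b t with hM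
  have hlt : ∀ v, ∑ t ∈ Finset.range (L v), levelCard z b t + φ v <
      ∑ t ∈ Finset.range (L v + 1), levelCard z b t := by
    intro v
    rw [Finset.sum_range_succ]
    exact Nat.add_lt_add_left (H.lt v) _
  let rank : V → Fin M := fun v => ⟨∑ t ∈ Finset.range (L v), levelCard z b t + φ v,
    (hlt v).trans_le (sum_levelCard_le z b (by have := H.le v; omega))⟩
  have hlevel : ∀ u v, rank u = rank v → L u ≤ L v := by
    intro u v huv
    by_contra hlt'
    have h1 := (hlt v).trans_le (sum_levelCard_le z b (show L v + 1 ≤ L u by omega))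
    have h2 := congrArg Fin.val huv
    simp only [rank] at h2
    omega
  have hinj : Function.Injective rank := by
    intro u v huv
    have h1 : L u = L v := le_antisymm (hlevel u v huv) (hlevel v u huv.symm)
    have h2 := congrArg Fin.val huv
    simp only [rank, h1] at h2
    exact H.inj u v h1 (by omega)
  have hsurj : Function.Surjective rank := by
    rintro ⟨r, hr⟩
    obtain ⟨l, hl, a, ha, hla⟩ := exists_eq_sum_levelCard_add z b _ r hr
    obtain ⟨v, hv, hva⟩ := H.surj l (by omega) a ha
    exact ⟨v, Fin.ext (by simp [rank, hv, hva, hla])⟩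
  have hcard : Fintype.card V = M := by
    simpa using Fintype.card_of_bijective ⟨hinj, hsurj⟩
  have hcount : ∀ l ≤ h, (Finset.univ.filter fun v => L v = l).card = levelCard z b l := by
    intro l hl
    rw [← Finset.card_range (levelCard z b l)]
    refine Finset.card_bij (fun v _ => φ v) ?_ ?_ ?_
    · intro v hv
      rw [Finset.mem_filter] at hv
      rw [Finset.mem_range, ← hv.2]
      exact H.lt v
    · intro u hu v hv huv
      rw [Finset.mem_filter] at hu hv
      exact H.inj u v (hu.2.trans hv.2.symm) huv
    · intro a ha
      obtain ⟨v, hv, hva⟩ := H.surj l hl a (Finset.mem_range.mp ha)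
      exact ⟨v, by simp [hv], hva⟩
  refine ⟨hcard, fun f => ?_, ?_⟩
  · rw [← Finset.sum_fiberwise_of_maps_to (s := Finset.univ) (t := Finset.range (h + 1)) (g := L)
      (fun v _ => Finset.mem_range.mpr (by have := H.le v; omega))]
    refine Finset.sum_congr rfl fun l hl => ?_
    rw [← hcount l (by rw [Finset.mem_range] at hl; omega), Finset.sum_congr rfl (g := fun _ => f l)
      (fun v hv => by rw [(Finset.mem_filter.mp hv).2])]
    simp
  · obtain ⟨v0⟩ := H.conn.nonempty
    have hex : ∀ r, ∃ v, r < Fintype.card V →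
        ∑ t ∈ Finset.range (L v), levelCard z b t + φ v = r := by
      intro r
      by_cases hr : r < Fintype.card V
      · obtain ⟨v, hv⟩ := hsurj ⟨r, hcard ▸ hr⟩
        exact ⟨v, fun _ => congrArg Fin.val hv⟩
      · exact ⟨v0, fun h => absurd h hr⟩
    choose vtx hvtx using hex
    exact ⟨vtx, hvtx⟩

variable {u v : V} {r r' : ℕ}

theorem rank_modEq {c : ℕ} (hu : ∑ t ∈ Finset.range (L u), levelCard z b t + φ u = r)
    (hv : ∑ t ∈ Finset.range (L v), levelCard z b t + φ v = r') (hcu : c ≤ L u) (hcv : c ≤ L v)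
    (huv : φ u ≡ φ v [MOD levelCard z b c]) : r ≡ r' [MOD levelCard z b c] := by
  rw [← hu, ← hv]
  exact ((sum_levelCard_modEq z b hcu).trans (sum_levelCard_modEq z b hcv).symm).add huv

theorem le_rank {l : ℕ} (hu : ∑ t ∈ Finset.range (L u), levelCard z b t + φ u = r)
    (hl : l ≤ L u) : ∑ t ∈ Finset.range l, levelCard z b t ≤ r := by
  have := sum_levelCard_le z b hl
  omega

theorem level_eq_zero_of_rank_lt (hu : ∑ t ∈ Finset.range (L u), levelCard z b t + φ u = r)
    (hr : r < z) : L u = 0 := by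
  by_contra h0
  have := le_rank (l := 1) hu (by omega)
  simp [levelCard_zero] at this
  omega

theorem level_le_one_of_rank_eq (hb : ∀ i < h, 2 ≤ b i) (hb0 : z = 1 → 3 ≤ b 0)
    (hz : z = 1 ∨ z = 2) (hh : 1 ≤ h)
    (hu : ∑ t ∈ Finset.range (L u), levelCard z b t + φ u = z) : L u ≤ 1 := by
  by_contra h0
  have h1 := le_rank (l := 2) hu (by omega)
  have h2 := levelCard_pos hb hb0 hz hh
  simp [Finset.sum_range_succ, levelCard_zero] at h1
  omega

end IsLeveled

theorem mod_ne_mod_of_lt {n x y : ℕ} (h1 : x < y) (h2 : y < x + n) : x % n ≠ y % n := by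
  intro h
  have h3 : n ∣ y - x := (Nat.modEq_iff_dvd' h1.le).mp h
  have := Nat.le_of_dvd (by omega) h3
  omega

theorem mod_ne_mod_of_near {n x y : ℕ} (hn : 3 ≤ n) (hne : x ≠ y) (h1 : x ≤ y + 2)
    (h2 : y ≤ x + 2) : x % n ≠ y % n := by
  rcases Nat.lt_or_gt_of_ne hne with h | h
  · exact mod_ne_mod_of_lt h (by omega)
  · exact (mod_ne_mod_of_lt h (by omega)).symm

theorem succ_mod_cases (p : ℕ) {m : ℕ} (hm : 0 < m) :
    (p % m + 1 < m ∧ (p + 1) % m = p % m + 1 ∧ (p + 1) / m = p / m) ∨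
    (p % m + 1 = m ∧ (p + 1) % m = 0 ∧ (p + 1) / m = p / m + 1) := by
  have h1 := Nat.mod_lt p hm
  have h2 := Nat.div_add_mod p m
  rcases Nat.lt_or_ge (p % m + 1) m with h | h
  · left
    refine ⟨h, ?_, ?_⟩
    · rw [Nat.add_mod_of_add_mod_lt] <;> rw [Nat.mod_eq_of_lt (show 1 < m by omega)]
      exact h
    · rw [Nat.div_eq_iff hm]
      constructor
      · rw [mul_comm]; omega
      · rw [mul_comm]; omega
  · right
    have h3 : p + 1 = m * (p / m + 1) := by rw [Nat.mul_add]; omega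
    refine ⟨by omega, ?_, ?_⟩
    · rw [h3, Nat.mul_mod_right]
    · rw [h3, Nat.mul_div_cancel_left _ hm]

theorem eq_of_mod_eq_of_div_modEq {n m p q c : ℕ} (hp : p < m * n) (hq : q < m * n)
    (hmod : p % m = q % m) (hdiv : (p / m + c) % n = (q / m + c) % n) : p = q := by
  have h1 := Nat.ModEq.add_right_cancel' c hdiv
  have h2 := Nat.ModEq.eq_of_lt_of_lt h1 (Nat.div_lt_of_lt_mul hp) (Nat.div_lt_of_lt_mul hq)
  rw [← Nat.div_add_mod p m, ← Nat.div_add_mod q m, h2, hmod]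

/-! ### Orderings of the vertices of the product -/

/-- The `K_n`-coordinates along one copy of a tree of order `m` with two roots: a pattern of
period 3 which, when the coordinates are raised by one from each copy to the next, also differs
from its neighbour at the seam. -/
def alternatingColor (m p : ℕ) : ℕ :=
  (if (m - 1) % 3 = 1 then 2 * (p % m) else p % m) % 3 + p / m

theorem alternatingColor_succ {m n : ℕ} (hm : 2 ≤ m) (hn : 3 ≤ n) (p : ℕ) :
    alternatingColor m p % n ≠ alternatingColor m (p + 1) % n := by
  unfold alternatingColor
  rcases succ_mod_cases p (show 0 < m by omega) with ⟨h1, h2, h3⟩ | ⟨h1, h2, h3⟩ <;>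
    rw [h2, h3] <;> refine mod_ne_mod_of_near hn ?_ ?_ ?_ <;> split_ifs <;> omega

theorem alternatingColor_add {m n p q : ℕ} (hn : 3 ≤ n) (hpq : p / m = q / m)
    (h : q = p + 2 ∨ q = p + 4) : alternatingColor m p % n ≠ alternatingColor m q % n := by
  have h1 := Nat.div_add_mod p m
  have h2 := Nat.div_add_mod q m
  rw [← hpq] at h2
  unfold alternatingColor
  rw [← hpq]
  refine mod_ne_mod_of_near hn ?_ ?_ ?_ <;> split_ifs <;> omega

namespace IsLeveled

variable {V : Type*} {T : SimpleGraph V} {z h : ℕ} {b : ℕ → ℕ} {L φ : V → ℕ}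

/-- Two roots: the product is traversed in `n` copies of the tree, each starting at one root,
ending at the other, and alternating between the two sides. -/
theorem exists_sequence_of_two_roots [Fintype V] (H : IsLeveled T 2 h b L φ)
    (hb : ∀ i < h, 2 ≤ b i) (hh : 1 ≤ h) {n : ℕ} (hn : 3 ≤ n) :
    ∃ s : ℕ → V × Fin n, Set.InjOn s (Set.Iio (Fintype.card V * n)) ∧ L (s 0).1 = 0 ∧
      L (s (Fintype.card V * n - 1)).1 = 0 ∧
      ∀ p q, p < q → q < Fintype.card V * n →
        2 * h + 2 + 1 + gapSum (fun t => h - L (s t).1) p ≤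
          T.dist (s p).1 (s q).1 + (if (s p).2 = (s q).2 then 0 else 1) +
            gapSum (fun t => h - L (s t).1) q := by
  have hz : (2 : ℕ) = 1 ∨ (2 : ℕ) = 2 := Or.inr rfl
  have hb0 : (2 : ℕ) = 1 → 3 ≤ b 0 := by omega
  obtain ⟨hcard, _, vtx, hvtx⟩ := H.exists_enumeration
  set m := Fintype.card V with hm
  have hm_even : 2 ∣ m := by
    rw [hcard]
    exact Finset.dvd_sum fun t _ => dvd_mul_right _ _
  have hm3 : 2 < m := by
    have h1 := sum_levelCard_le 2 b (show 2 ≤ h + 1 by omega)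
    have h2 := levelCard_pos hb hb0 hz hh
    simp only [Finset.sum_range_succ, Finset.sum_range_zero, levelCard_zero] at h1
    rw [hcard, Finset.sum_range_succ]
    omega
  have hm0 : 0 < m := by omega
  have hn0 : 0 < n := by omega
  let s : ℕ → V × Fin n := fun p =>
    (vtx ((p + 1) % m), ⟨alternatingColor m p % n, Nat.mod_lt _ hn0⟩)
  have hrank : ∀ p, ∑ t ∈ Finset.range (L (s p).1), levelCard 2 b t + φ (s p).1 = (p + 1) % m :=
    fun p => hvtx _ (Nat.mod_lt _ hm0)
  have hroot : ∀ p, (p + 1) % m < 2 → L (s p).1 = 0 := fun p hp =>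
    level_eq_zero_of_rank_lt (hrank p) hp
  have hcol : ∀ p q, alternatingColor m p % n ≠ alternatingColor m q % n → (s p).2 ≠ (s q).2 :=
    fun p q hpq h => hpq (congrArg Fin.val h)
  refine ⟨s, ?_, hroot 0 ?_, hroot _ ?_, ?_⟩
  · intro p hp q hq hpq
    rw [Set.mem_Iio] at hp hq
    have h1 : (p + 1) % m = (q + 1) % m := by rw [← hrank p, hpq, hrank q]
    have h2 : p % m = q % m := Nat.ModEq.add_right_cancel' 1 h1
    have h3 := congrArg (fun x => (x.2 : ℕ)) hpq
    simp only [s, alternatingColor, h2] at h3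
    rw [add_comm, add_comm _ (q / m)] at h3
    exact eq_of_mod_eq_of_div_modEq hp hq h2 h3
  · rw [Nat.mod_eq_of_lt (by omega)]; omega
  · rw [Nat.sub_add_cancel (Nat.mul_pos hm0 hn0), Nat.mul_mod_right]; omega
  intro p q hpq _
  have hgap := gapSum_add_le (fun t => h - L (s t).1) hpq
  have hgap' := fun t (h1 : p < t) (h2 : t < q) =>
    gapSum_add_le_of_lt_of_lt (fun t => h - L (s t).1) h1 h2
  have hLp := H.le (s p).1
  have hLq := H.le (s q).1
  rcases H.dist_cases hz (s p).1 (s q).1 with ⟨c, hc1, hc2, hc3, hc4⟩ | ⟨_, h2⟩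
  swap
  -- On opposite sides only consecutive vertices need different `K_n`-coordinates.
  · by_cases hq : q = p + 1
    · subst hq
      rw [if_neg (hcol _ _ (alternatingColor_succ (by omega) hn p))]
      omega
    · omega
  have hmod := rank_modEq (hrank p) (hrank q) hc1 hc2 hc3
  have hs2 : 2 ∣ q - p := by
    have h1 : (p + 1) % m ≡ (q + 1) % m [MOD 2] := hmod.of_dvd (dvd_mul_right _ _)
    have h2 : p + 1 ≡ q + 1 [MOD 2] :=
      ((Nat.mod_modEq (p + 1) m).of_dvd hm_even).symm.trans
        (h1.trans ((Nat.mod_modEq (q + 1) m).of_dvd hm_even))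
    exact (Nat.modEq_iff_dvd' hpq.le).mp (Nat.ModEq.add_right_cancel' 1 h2)
  have hp1 := succ_mod_cases p hm0
  have hq1 := succ_mod_cases q hm0
  have hdp := Nat.div_add_mod p m
  have hdq := Nat.div_add_mod q m
  rcases Nat.eq_zero_or_pos c with rfl | hc
  · by_cases hq : q = p + 2
    · by_cases hpass : p / m = q / m
      · rw [if_neg (hcol _ _ (alternatingColor_add hn hpass (Or.inl hq)))]
        omega
      · have h3 := succ_mod_cases (p + 1) hm0
        have h4 : L (s (p + 1)).1 = 0 := by
          refine hroot _ ?_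
          subst hq
          change ¬ p / m = (p + 1 + 1) / m at hpass
          rcases hp1 with ⟨_, _, _⟩ | ⟨_, _, _⟩ <;> rcases h3 with ⟨_, _, _⟩ | ⟨_, _, _⟩ <;> omega
        have h5 := hgap' (p + 1) (by omega) (by omega)
        simp only [h4] at h5
        omega
    · omega
  · have hr : ∀ x, c ≤ L (s x).1 → 2 ≤ (x + 1) % m := fun x hx => by
      have := le_rank (l := 1) (hrank x) (by omega)
      simpa [levelCard_zero] using this
    have hrp := hr p hc1
    have hrq := hr q hc2
    by_cases hpass : p / m = q / m
    · have h3 : levelCard 2 b c ∣ q - p := by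
        have h4 : p % m + 1 ≡ q % m + 1 [MOD levelCard 2 b c] := by
          rcases hp1 with ⟨_, h5, _⟩ | ⟨_, h5, _⟩ <;> rcases hq1 with ⟨_, h6, _⟩ | ⟨_, h6, _⟩
          · rwa [h5, h6] at hmod
          all_goals omega
        have h5 := Nat.ModEq.add_right_cancel' 1 h4
        rw [← hpass] at hdq
        have h6 : q - p = q % m - p % m := by omega
        rw [h6]
        exact (Nat.modEq_iff_dvd' (by omega)).mp h5
      have h4 := Nat.le_of_dvd (by omega) h3
      obtain ⟨_, _, h5⟩ := le_levelCard hb hb0 hz c hc (by omega)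
      obtain ⟨h5, h6⟩ := h5 rfl
      rcases Nat.lt_or_ge c 2 with hc' | hc'
      · by_cases hq : q = p + 4
        · rw [if_neg (hcol _ _ (alternatingColor_add hn hpass (Or.inr hq)))]
          omega
        · omega
      · have := h6 hc'
        omega
    · -- The first vertex of the later copy lies strictly between and is a root.
      have hlt : p / m + 1 ≤ q / m :=
        lt_of_le_of_ne (Nat.div_le_div_right hpq.le) hpass
      have h3 := Nat.mul_le_mul_left m hlt
      rw [Nat.mul_add, Nat.mul_one] at h3
      have h4 : L (s (m * (q / m))).1 = 0 := by
        refine hroot _ ?_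
        rw [Nat.mul_add_mod, Nat.mod_eq_of_lt (by omega)]
        omega
      have h5 : p + 2 ≤ m * (q / m) := by
        rcases hp1 with ⟨_, _, _⟩ | ⟨_, _, _⟩ <;> omega
      have h6 : m * (q / m) + 1 ≤ q := by
        rcases hq1 with ⟨_, _, _⟩ | ⟨_, _, _⟩ <;> omega
      have h7 := hgap' (m * (q / m)) (by omega) (by omega)
      simp only [h4] at h7
      omega

end IsLeveled

/-- The `K_n`-coordinates along the traversals of a tree with one root of degree `k`, the root
being omitted. The vertices come in groups of `k` successive vertices, one for each branch, and a
traversal consists of `g` groups. The first summand, which depends only on the group, changes from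
each group to the next; the second one changes within a group and vanishes at both of its ends. -/
def groupColor (k g j : ℕ) : ℕ :=
  (j / k / g + if j / k % g + 1 = g then 2 else j / k % g % 2) +
    if j % k = 0 ∨ j % k + 1 = k then 0 else 1 + j % k % 2

theorem groupShift_near {n g : ℕ} (hg : 0 < g) (i c : ℕ) (hn : 3 ≤ n) :
    ((i / g + if i % g + 1 = g then 2 else i % g % 2) + c) % n ≠
      (((i + 1) / g + if (i + 1) % g + 1 = g then 2 else (i + 1) % g % 2) + c) % n := by
  rcases succ_mod_cases i hg with ⟨h1, h2, h3⟩ | ⟨h1, h2, h3⟩ <;> rw [h2, h3] <;>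
    refine mod_ne_mod_of_near hn ?_ ?_ ?_ <;> split_ifs <;> omega

theorem groupColor_add {n k g : ℕ} (hk : 3 ≤ k) (hg : 0 < g) (hn : 3 ≤ n) (j : ℕ) :
    groupColor k g j % n ≠ groupColor k g (j + k) % n := by
  unfold groupColor
  rw [Nat.add_mod_right, Nat.add_div_right _ (by omega)]
  exact groupShift_near hg _ _ hn

theorem groupColor_succ {n k g : ℕ} (hk : 3 ≤ k) (hg : 0 < g) (hn : 3 ≤ n) (j : ℕ) :
    groupColor k g j % n ≠ groupColor k g (j + 1) % n := by
  unfold groupColor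
  rcases succ_mod_cases j (show 0 < k by omega) with ⟨h1, h2, h3⟩ | ⟨h1, h2, h3⟩
  · rw [h2, h3]
    refine mod_ne_mod_of_near hn ?_ ?_ ?_ <;>
      generalize (j / k / g + if j / k % g + 1 = g then 2 else j / k % g % 2) = x <;>
      simp only [Nat.succ_ne_zero, false_or] <;> split_ifs <;> omega
  · rw [h2, h3, if_pos (Or.inr h1), if_pos (Or.inl rfl)]
    exact groupShift_near hg _ _ hn

theorem groupColor_zero (k : ℕ) {g : ℕ} :
    groupColor k g 0 = 0 ∨ groupColor k g 0 = 2 := by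
  unfold groupColor
  simp only [Nat.zero_div, Nat.zero_mod, true_or, if_true]
  split_ifs <;> omega

theorem groupColor_last {k g n : ℕ} (hk : 0 < k) (hg : 0 < g) (hn : 0 < n) :
    groupColor k g (k * g * n - 1) = n + 1 := by
  have h1 : k * g * n - 1 = k * (g * n - 1) + (k - 1) := by
    have h2 : 0 < g * n := Nat.mul_pos hg hn
    have h3 : k * (g * n - 1) + k = k * (g * n) := by
      rw [← Nat.mul_succ]; congr 1; omega
    rw [mul_assoc]
    omega
  have h2 : (k * g * n - 1) / k = g * n - 1 := by
    rw [h1, Nat.mul_add_div hk, Nat.div_eq_of_lt (show k - 1 < k by omega)]; omega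
  have h3 : (k * g * n - 1) % k = k - 1 := by
    rw [h1, Nat.mul_add_mod, Nat.mod_eq_of_lt (show k - 1 < k by omega)]
  have h4 : g * n - 1 = g * (n - 1) + (g - 1) := by
    have h5 : g * (n - 1) + g = g * n := by
      rw [← Nat.mul_succ]; congr 1; omega
    omega
  have h5 : (g * n - 1) / g = n - 1 := by
    rw [h4, Nat.mul_add_div hg, Nat.div_eq_of_lt (show g - 1 < g by omega)]; omega
  have h6 : (g * n - 1) % g = g - 1 := by
    rw [h4, Nat.mul_add_mod, Nat.mod_eq_of_lt (show g - 1 < g by omega)]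
  unfold groupColor
  rw [h2, h3, h5, h6, if_pos (by omega), if_pos (by omega)]
  omega

theorem groupColor_injOn {k g n : ℕ} {i j : ℕ} (hi : i < k * g * n)
    (hj : j < k * g * n) (hmod : i % (k * g) = j % (k * g))
    (hcol : groupColor k g i % n = groupColor k g j % n) : i = j := by
  have h1 : i % k = j % k := Nat.ModEq.of_dvd (dvd_mul_right k g) hmod
  have h2 : i / k % g = j / k % g := by
    rw [← Nat.mod_mul_right_div_self, ← Nat.mod_mul_right_div_self, hmod]
  unfold groupColor at hcol
  rw [h1, h2, Nat.div_div_eq_div_mul, Nat.div_div_eq_div_mul, add_assoc, add_assoc] at hcol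
  exact eq_of_mod_eq_of_div_modEq hi hj hmod hcol

namespace IsLeveled

variable {V : Type*} {T : SimpleGraph V} {z h : ℕ} {b : ℕ → ℕ} {L φ : V → ℕ}

/-- One root: all copies of the root but one come first, then the other vertices are traversed
`n` times, level by level, and the last copy of the root ends the sequence. -/
theorem exists_sequence_of_one_root [Fintype V] (H : IsLeveled T 1 h b L φ)
    (hb : ∀ i < h, 2 ≤ b i) (hb0 : (1 : ℕ) = 1 → 3 ≤ b 0) (hh : 1 ≤ h) {n : ℕ} (hn : 3 ≤ n) :
    ∃ s : ℕ → V × Fin n, Set.InjOn s (Set.Iio (Fintype.card V * n)) ∧ L (s 0).1 = 0 ∧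
      L (s (Fintype.card V * n - 1)).1 = 0 ∧
      ∀ p q, p < q → q < Fintype.card V * n →
        2 * h + 1 + 1 + gapSum (fun t => h - L (s t).1) p ≤
          T.dist (s p).1 (s q).1 + (if (s p).2 = (s q).2 then 0 else 1) +
            gapSum (fun t => h - L (s t).1) q := by
  have hz : (1 : ℕ) = 1 ∨ (1 : ℕ) = 2 := Or.inl rfl
  have hb3 := hb0 rfl
  obtain ⟨hcard, _, vtx, hvtx⟩ := H.exists_enumeration
  have hP1 : levelCard 1 b 1 = b 0 := by rw [levelCard_succ, levelCard_zero, one_mul]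
  obtain ⟨g, hg⟩ : b 0 ∣ ∑ t ∈ Finset.range h, levelCard 1 b (t + 1) :=
    Finset.dvd_sum fun t _ => hP1 ▸ levelCard_dvd 1 b (by omega)
  set m := Fintype.card V with hm
  have hmg : m = b 0 * g + 1 := by
    rw [hcard, Finset.sum_range_succ', hg, levelCard_zero]
  have hg0 : 0 < g := by
    rcases Nat.eq_zero_or_pos g with rfl | h0
    · rw [mul_zero, Finset.sum_eq_zero_iff] at hg
      have := hg 0 (Finset.mem_range.mpr hh)
      rw [zero_add, hP1] at this
      omega
    · exact h0
  set R := b 0 * g with hR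
  have hR0 : 0 < R := Nat.mul_pos (by omega) hg0
  have hN : m * n = R * n + n := by rw [hmg]; ring
  have hRn : 0 < R * n := Nat.mul_pos hR0 (by omega)
  have hn0 : 0 < n := by omega
  let s : ℕ → V × Fin n := fun p =>
    if p < n - 1 then (vtx 0, ⟨(n - 1 - p) % n, Nat.mod_lt _ hn0⟩)
    else if p < n - 1 + R * n then
      (vtx ((p - (n - 1)) % R + 1), ⟨groupColor (b 0) g (p - (n - 1)) % n, Nat.mod_lt _ hn0⟩)
    else (vtx 0, ⟨0, hn0⟩)
  have hs1 : ∀ p, p < n - 1 → s p = (vtx 0, ⟨(n - 1 - p) % n, Nat.mod_lt _ hn0⟩) :=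
    fun p hp => if_pos hp
  have hs2 : ∀ j, j < R * n → s (n - 1 + j) =
      (vtx (j % R + 1), ⟨groupColor (b 0) g j % n, Nat.mod_lt _ hn0⟩) := by
    intro j hj
    simp only [s]
    rw [if_neg (by omega), if_pos (by omega)]
    simp only [Nat.add_sub_cancel_left]
  have hs3 : s (n - 1 + R * n) = (vtx 0, ⟨0, hn0⟩) := by
    simp only [s]
    rw [if_neg (by omega), if_neg (by omega)]
  have hroot : L (vtx 0) = 0 := level_eq_zero_of_rank_lt (hvtx 0 (by omega)) (by omega)
  have hrank : ∀ j, ∑ t ∈ Finset.range (L (vtx (j % R + 1))), levelCard 1 b t +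
      φ (vtx (j % R + 1)) = j % R + 1 := fun j =>
    hvtx _ (by have := Nat.mod_lt j hR0; omega)
  have hcases : ∀ p, p < m * n →
      p < n - 1 ∨ (∃ j < R * n, p = n - 1 + j) ∨ p = n - 1 + R * n := by
    intro p hp
    rcases Nat.lt_or_ge p (n - 1) with h1 | h1
    · exact Or.inl h1
    rcases Nat.lt_or_ge p (n - 1 + R * n) with h2 | h2
    · exact Or.inr (Or.inl ⟨p - (n - 1), by omega, by omega⟩)
    · exact Or.inr (Or.inr (by omega))
  have hnonroot : ∀ j, vtx (j % R + 1) ≠ vtx 0 := by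
    intro j h0
    have h1 := hrank j
    rw [h0, hvtx 0 (by omega)] at h1
    omega
  refine ⟨s, ?_, ?_, ?_, ?_⟩
  · intro p hp q hq hpq
    have hv := congrArg Prod.fst hpq
    have hk := congrArg (fun x => (x.2 : ℕ)) hpq
    rcases hcases p hp with h1 | ⟨i, hi, rfl⟩ | rfl <;>
      rcases hcases q hq with h2 | ⟨j, hj, rfl⟩ | rfl
    · rw [hs1 p h1, hs1 q h2] at hk
      simp only at hk
      rw [Nat.mod_eq_of_lt (by omega), Nat.mod_eq_of_lt (by omega)] at hk
      omega
    · rw [hs1 p h1, hs2 j hj] at hv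
      exact absurd hv.symm (hnonroot j)
    · rw [hs1 p h1, hs3] at hk
      simp only at hk
      rw [Nat.mod_eq_of_lt (by omega)] at hk
      omega
    · rw [hs1 q h2, hs2 i hi] at hv
      exact absurd hv (hnonroot i)
    · rw [hs2 i hi, hs2 j hj] at hv hk
      have h1 := hrank i
      rw [show vtx (i % R + 1) = vtx (j % R + 1) from hv, hrank j] at h1
      rw [groupColor_injOn hi hj (show i % R = j % R by omega) hk]
    · rw [hs2 i hi, hs3] at hv
      exact absurd hv (hnonroot i)
    · rw [hs1 q h2, hs3] at hk
      simp only at hk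
      rw [Nat.mod_eq_of_lt (show n - 1 - q < n by omega)] at hk
      omega
    · rw [hs2 j hj, hs3] at hv
      exact absurd hv.symm (hnonroot j)
    · rfl
  · rw [hs1 0 (by omega)]; exact hroot
  · rw [show m * n - 1 = n - 1 + R * n by omega, hs3]; exact hroot
  intro p q hpq hqN
  have hgap := gapSum_add_le (fun t => h - L (s t).1) hpq
  have hgap' := fun t (h1 : p < t) (h2 : t < q) =>
    gapSum_add_le_of_lt_of_lt (fun t => h - L (s t).1) h1 h2
  have hLp := H.le (s p).1
  have hLq := H.le (s q).1
  have hcol : q = p + 1 → (s p).2 ≠ (s q).2 := by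
    rintro rfl heq
    have hk := congrArg Fin.val heq
    rcases hcases p (by omega) with h1 | ⟨i, hi, rfl⟩ | rfl
    · rcases Nat.lt_or_ge (p + 1) (n - 1) with h2 | h2
      · rw [hs1 p h1, hs1 _ h2] at hk
        simp only at hk
        rw [Nat.mod_eq_of_lt (by omega), Nat.mod_eq_of_lt (by omega)] at hk
        omega
      · rw [hs1 p h1, show p + 1 = n - 1 + 0 by omega, hs2 0 hRn] at hk
        simp only at hk
        rw [Nat.mod_eq_of_lt (by omega)] at hk
        rcases groupColor_zero (b 0) (g := g) with h3 | h3 <;> rw [h3] at hk <;>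
          rw [Nat.mod_eq_of_lt (by omega)] at hk <;> omega
    · rcases Nat.lt_or_ge (i + 1) (R * n) with h2 | h2
      · rw [hs2 i hi, add_assoc, hs2 _ h2] at hk
        exact groupColor_succ hb3 hg0 hn i hk
      · rw [hs2 i hi, show n - 1 + i + 1 = n - 1 + R * n by omega, hs3,
          show i = R * n - 1 by omega] at hk
        simp only [hR] at hk
        rw [groupColor_last (by omega) hg0 hn0, Nat.add_mod_left, Nat.mod_eq_of_lt (by omega)] at hk
        omega
    · omega
  rcases H.dist_cases hz (s p).1 (s q).1 with ⟨c, hc1, hc2, hc3, hc4⟩ | ⟨h1, _⟩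
  swap
  · exact absurd Nat.modEq_one h1
  rcases Nat.eq_zero_or_pos c with rfl | hc
  · by_cases hq : q = p + 1
    · rw [if_neg (hcol hq)]
      omega
    · omega
  rcases hcases p (by omega) with h1 | ⟨i, hi, rfl⟩ | rfl
  · rw [hs1 p h1, hroot] at hc1; omega
  swap
  · rw [hs3, hroot] at hc1; omega
  rcases hcases q hqN with h1 | ⟨j, hj, rfl⟩ | rfl
  · omega
  swap
  · rw [hs3, hroot] at hc2; omega
  rw [hs2 i hi, hs2 j hj] at hc3
  have hci : c ≤ L (vtx (i % R + 1)) := by rwa [hs2 i hi] at hc1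
  have hcj : c ≤ L (vtx (j % R + 1)) := by rwa [hs2 j hj] at hc2
  have hmod := Nat.ModEq.add_right_cancel' 1 (rank_modEq (hrank i) (hrank j) hci hcj hc3)
  -- Vertices of the same branch are a multiple of the number of branches apart.
  have hdvd : b 0 ∣ j - i := by
    have h1 : i % R ≡ j % R [MOD b 0] := by
      have := hmod.of_dvd (levelCard_dvd 1 b hc)
      rwa [hP1] at this
    have h2 : i ≡ j [MOD b 0] :=
      ((Nat.mod_modEq i R).of_dvd (dvd_mul_right _ _)).symm.trans
        (h1.trans ((Nat.mod_modEq j R).of_dvd (dvd_mul_right _ _)))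
    exact (Nat.modEq_iff_dvd' (by omega)).mp h2
  have h3 := Nat.le_of_dvd (by omega) hdvd
  rcases Nat.lt_or_ge c 2 with hc' | hc'
  · by_cases hq : j = i + 3
    · have h4 : (s (n - 1 + i)).2 ≠ (s (n - 1 + j)).2 := by
        intro heq
        have hk := congrArg Fin.val heq
        rw [hs2 i hi, hs2 j hj, hq, show i + 3 = i + b 0 by omega] at hk
        exact groupColor_add hb3 hg0 hn i hk
      rw [if_neg h4]
      omega
    · omega
  have hdi := Nat.div_add_mod i R
  have hdj := Nat.div_add_mod j R
  have hmi := Nat.mod_lt i hR0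
  by_cases hpass : i / R = j / R
  · have h5 : levelCard 1 b c ∣ j - i := by
      rw [← hpass] at hdj
      rw [show j - i = j % R - i % R by omega]
      exact (Nat.modEq_iff_dvd' (by omega)).mp hmod
    have h6 := Nat.le_of_dvd (by omega) h5
    obtain ⟨_, h7, _⟩ := le_levelCard hb hb0 hz c hc (by omega)
    have := h7 hc'
    omega
  · -- The later traversal starts with vertices of level one, which lie strictly between.
    have hlt : i / R + 1 ≤ j / R :=
      lt_of_le_of_ne (Nat.div_le_div_right (by omega)) hpass
    have h4 := Nat.mul_le_mul_left R hlt
    rw [Nat.mul_add, Nat.mul_one] at h4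
    have h5 := le_rank (l := 2) (hrank j) (by omega)
    simp only [Finset.sum_range_succ, Finset.sum_range_zero, levelCard_zero, hP1] at h5
    have h6 : L (s (n - 1 + R * (j / R))).1 ≤ 1 := by
      rw [hs2 _ (by omega), Nat.mul_mod_right]
      exact level_le_one_of_rank_eq hb hb0 hz hh (hvtx 1 (by omega))
    have h7 := hgap' (n - 1 + R * (j / R)) (by omega) (by omega)
    omega

end IsLeveled

/-! ### Closed formulas for the radio number -/

theorem two_le_childCount {z h : ℕ} {d : ℕ → ℕ} (hd : ∀ i < h, 3 ≤ d i) (hz : z = 1 ∨ z = 2) :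
    ∀ i < h, 2 ≤ childCount z d i := by
  intro i hi
  have h1 := hd i hi
  unfold childCount
  split_ifs with h0
  · subst h0
    omega
  · omega

theorem levelCard_one_succ {h : ℕ} {d : ℕ → ℕ} (hd : ∀ i < h, 3 ≤ d i) (t : ℕ) (ht : t < h) :
    (levelCard 1 (childCount 1 d) (t + 1) : ℤ) =
      d 0 * ∏ j ∈ Finset.Icc 1 t, ((d j : ℤ) - 1) := by
  induction t with
  | zero => simp [levelCard, childCount]
  | succ t ih =>
    have h1 := hd (t + 1) ht
    rw [levelCard_succ, Nat.cast_mul, ih (by omega), Finset.prod_Icc_succ_top (by omega)]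
    simp only [childCount, Nat.succ_ne_zero, if_false]
    push_cast [show 1 ≤ d (t + 1) by omega]
    ring

theorem levelCard_two_succ {h : ℕ} {d : ℕ → ℕ} (hd : ∀ i < h, 3 ≤ d i) (t : ℕ) (ht : t < h) :
    (levelCard 2 (childCount 2 d) (t + 1) : ℤ) = 2 * ∏ j ∈ Finset.Icc 0 t, ((d j : ℤ) - 1) := by
  induction t with
  | zero =>
    have h1 := hd 0 ht
    simp only [levelCard, childCount, zero_add, Finset.prod_range_one, if_true, Finset.Icc_self,
      Finset.prod_singleton]
    omega
  | succ t ih =>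
    have h1 := hd (t + 1) ht
    rw [levelCard_succ, Nat.cast_mul, ih (by omega), Finset.prod_Icc_succ_top (by omega)]
    simp only [childCount, Nat.succ_ne_zero, if_false]
    push_cast [show 1 ≤ d (t + 1) by omega]
    ring

theorem sum_range_succ_eq_add_sum_Icc (F : ℕ → ℤ) (k : ℕ) :
    ∑ t ∈ Finset.range (k + 1), F t = F 0 + ∑ t ∈ Finset.Icc 1 k, F t := by
  induction k with
  | zero => simp
  | succ k ih => rw [Finset.sum_range_succ, ih, Finset.sum_Icc_succ_top (by omega), add_assoc]

theorem sum_range_succ_eq_sum_Icc (F : ℕ → ℤ) (k : ℕ) :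
    ∑ t ∈ Finset.range (k + 1), F t = ∑ t ∈ Finset.Icc 0 k, F t := by
  congr 1
  ext t
  simp only [Finset.mem_range, Finset.mem_Icc]
  omega

namespace IsLevelwiseRegularTree

variable {V : Type*} [Fintype V] {T : SimpleGraph V} {z h n : ℕ} {d : ℕ → ℕ}

/-- The radio number in terms of the levels of the vertices. -/
theorem radioNumber_add_eq (hT : IsLevelwiseRegularTree T z h d) (hh : 1 ≤ h)
    (hd : ∀ i < h, 3 ≤ d i) (hn : 3 ≤ n) (hz : z = 1 ∨ z = 2) :
    radioNumber (T □ completeGraph (Fin n)) + 2 * h + 1 =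
      Fintype.card V * n + 2 * (n * ∑ v, (h - levelFrom T T.center v)) := by
  obtain ⟨φ, H⟩ := hT.exists_isLeveled
  have hb := two_le_childCount hd hz
  have hb0 : z = 1 → 3 ≤ childCount z d 0 := by
    rintro rfl
    simpa [childCount] using hd 0 hh
  have hz' := hz
  rcases hz with rfl | rfl
  · obtain ⟨s, h1, h2, h3, h4⟩ := H.exists_sequence_of_one_root hb hb0 hh hn
    exact H.radioNumber_eq_of_sequence hb hb0 hz' hh (by omega) h1 h2 h3 h4
  · obtain ⟨s, h1, h2, h3, h4⟩ := H.exists_sequence_of_two_roots hb hh hn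
    exact H.radioNumber_eq_of_sequence hb hb0 hz' hh (by omega) h1 h2 h3 h4

theorem radioNumber_eq_radioLowerBound (hT : IsLevelwiseRegularTree T z h d) (hh : 1 ≤ h)
    (hd : ∀ i < h, 3 ≤ d i) (hn : 3 ≤ n) (hz : z = 1 ∨ z = 2) :
    (radioNumber (T □ completeGraph (Fin n)) : ℤ) = radioLowerBound T n := by
  have key := hT.radioNumber_add_eq hh hd hn hz
  obtain ⟨φ, H⟩ := hT.exists_isLeveled
  have hb := two_le_childCount hd hz
  have hb0 : z = 1 → 3 ≤ childCount z d 0 := by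
    rintro rfl
    simpa [childCount] using hd 0 hh
  have := hT.isTree.connected.nonempty
  have hW : weightCenters T = T.center := by
    ext v
    rw [H.mem_weightCenters_iff hb hb0 hz,
      levelFrom_eq_zero_iff hT.isTree.connected center_nonempty]
  have hdiam : (T.diam : ℤ) + weightEpsilon T = 2 * h + 1 := by
    rw [H.diam_eq hb hb0 hz hh, weightEpsilon, hW, hT.ncard_center]
    rcases hz with rfl | rfl <;> simp
  have hsum : ∑ v, (h - levelFrom T T.center v) + totalLevel T = Fintype.card V * h := by
    rw [totalLevel, hW, ← Finset.sum_add_distrib, Finset.sum_congr rfl (g := fun _ => h)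
      (fun v _ => Nat.sub_add_cancel (hT.level_le v))]
    simp
  rw [radioLowerBound, hdiam]
  have key' : (radioNumber (T □ completeGraph (Fin n)) : ℤ) + 2 * h + 1 =
      Fintype.card V * n + 2 * (n * (∑ v, (h - levelFrom T T.center v) : ℕ)) := by
    exact_mod_cast key
  have hsum' : ((∑ v, (h - levelFrom T T.center v) : ℕ) : ℤ) =
      Fintype.card V * h - totalLevel T := by
    rw [eq_sub_iff_add_eq]
    exact_mod_cast hsum
  rw [hsum'] at key'
  linear_combination key'

theorem radioNumber_add_eq_sum (hT : IsLevelwiseRegularTree T z h d) (hh : 1 ≤ h)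
    (hd : ∀ i < h, 3 ≤ d i) (hn : 3 ≤ n) (hz : z = 1 ∨ z = 2) :
    (radioNumber (T □ completeGraph (Fin n)) : ℤ) + 2 * h + 1 =
      n * (∑ t ∈ Finset.range h, levelCard z (childCount z d) (t + 1) *
        (2 * (h : ℤ) - 2 * t - 1) + z * (2 * h + 1)) := by
  have key := hT.radioNumber_add_eq hh hd hn hz
  obtain ⟨φ, H⟩ := hT.exists_isLeveled
  obtain ⟨hcard, hsum, _⟩ := H.exists_enumeration
  have h1 : Fintype.card V * n + 2 * (n * ∑ v, (h - levelFrom T T.center v)) =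
      n * ∑ t ∈ Finset.range (h + 1), levelCard z (childCount z d) t * (1 + 2 * (h - t)) := by
    rw [hsum (fun t => h - t), hcard, mul_comm, mul_left_comm, ← mul_add, Finset.mul_sum,
      ← Finset.sum_add_distrib]
    congr 1
    exact Finset.sum_congr rfl fun t _ => by ring
  rw [h1, Finset.sum_range_succ', levelCard_zero] at key
  have h2 : ((∑ t ∈ Finset.range h, levelCard z (childCount z d) (t + 1) *
      (1 + 2 * (h - (t + 1))) : ℕ) : ℤ) = ∑ t ∈ Finset.range h,
        levelCard z (childCount z d) (t + 1) * (2 * (h : ℤ) - 2 * t - 1) := by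
    rw [Nat.cast_sum]
    refine Finset.sum_congr rfl fun t ht => ?_
    rw [Finset.mem_range] at ht
    rw [Nat.cast_mul]
    congr 1
    omega
  rw [← h2]
  have key' := congrArg (Nat.cast (R := ℤ)) key
  rw [Nat.sub_zero] at key'
  push_cast at key' ⊢
  linear_combination key'

end IsLevelwiseRegularTree

theorem theorem4p1 {V : Type*} [Fintype V] (T : SimpleGraph V) (z h n : ℕ) (d : ℕ → ℕ)
    (hh : 1 ≤ h) (hd : ∀ i < h, 3 ≤ d i) (hn : 3 ≤ n)
    (hT : IsLevelwiseRegularTree T z h d) :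
    (z = 1 →
      (radioNumber (T □ completeGraph (Fin n)) : ℤ) =
          ((∑ i ∈ Finset.Icc 1 (h - 1),
              (2 * (h : ℤ) - 2 * (i : ℤ) - 1) * ∏ j ∈ Finset.Icc 1 i, ((d j : ℤ) - 1))
            + 2 * (h : ℤ) - 1) * (n : ℤ) * (d 0 : ℤ) + (2 * (h : ℤ) + 1) * ((n : ℤ) - 1) ∧
      (radioNumber (T □ completeGraph (Fin n)) : ℤ) = radioLowerBound T n) ∧
    (z = 2 →
      (radioNumber (T □ completeGraph (Fin n)) : ℤ) =
          ((∑ i ∈ Finset.Icc 0 (h - 1),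
              (2 * (h : ℤ) - 2 * (i : ℤ) - 1) * ∏ j ∈ Finset.Icc 0 i, ((d j : ℤ) - 1))
            + 2 * (h : ℤ) + 1) * (2 * (n : ℤ)) - 2 * (h : ℤ) - 1 ∧
      (radioNumber (T □ completeGraph (Fin n)) : ℤ) = radioLowerBound T n) := by
  refine ⟨?_, ?_⟩
  · rintro rfl
    refine ⟨?_, hT.radioNumber_eq_radioLowerBound hh hd hn (Or.inl rfl)⟩
    have key := hT.radioNumber_add_eq_sum hh hd hn (Or.inl rfl)
    rw [Finset.sum_congr rfl (g := fun t : ℕ => (d 0 : ℤ) * ((2 * (h : ℤ) - 2 * (t : ℤ) - 1) *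
        ∏ j ∈ Finset.Icc 1 t, ((d j : ℤ) - 1)))
      (fun t ht => by rw [levelCard_one_succ hd t (Finset.mem_range.mp ht)]; ring),
      ← Finset.mul_sum, ← Nat.sub_add_cancel hh, sum_range_succ_eq_add_sum_Icc,
      Nat.sub_add_cancel hh] at key
    simp only [Nat.cast_zero, Nat.cast_one, Finset.Icc_eq_empty_of_lt Nat.zero_lt_one,
      Finset.prod_empty] at key
    linear_combination key
  · rintro rfl
    refine ⟨?_, hT.radioNumber_eq_radioLowerBound hh hd hn (Or.inr rfl)⟩
    have key := hT.radioNumber_add_eq_sum hh hd hn (Or.inr rfl)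
    rw [Finset.sum_congr rfl (g := fun t : ℕ => 2 * ((2 * (h : ℤ) - 2 * (t : ℤ) - 1) *
        ∏ j ∈ Finset.Icc 0 t, ((d j : ℤ) - 1)))
      (fun t ht => by rw [levelCard_two_succ hd t (Finset.mem_range.mp ht)]; ring),
      ← Finset.mul_sum, ← Nat.sub_add_cancel hh, sum_range_succ_eq_sum_Icc,
      Nat.sub_add_cancel hh] at key
    push_cast at key
    linear_combination key
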